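/- Let $n\ge 1$, $N=2n+1$, and let $\mathbb H^n$ be the Heisenberg group, i.e. $\mathbb R^n\times\mathbb R^n\times\mathbb R$ with the group law $$(x,y,t)\cdot(x',y',t')=\Bigl(x+x',\,y+y',\,t+t'+2\sum_{j=1}^n(x'_jy_j-x_jy'_j)\Bigr),$$ dilations $\delta_\varepsilon(x,y,t)=(\varepsilon x,\varepsilon y,\varepsilon^2t)$ and Lebesgue measure. For $w=(x,y,t)$ write $w_{\mathcal H}=(x,y)\in\mathbb R^{2n}$, with Euclidean norm $|w_{\mathcal H}|$, and $w_N=t$. Let $Z_j=X_j=\partial_{x_j}+2y_j\partial_t$ and $Z_{n+j}=Y_j=\partial_{y_j}-2x_j\partial_t$ for $1\le j\le n$, and $T=\partial_t$. Let $d$ be the Carnot–Carathéodory distance: $d(p,q)$ is the infimum of the lengths of absolutely continuous curves from $p$ to $q$ whose velocity is a.e. of the form $\sum_{i\le 2n}u_iZ_i$, the length being $\int_0^1|u(\tau)|\,d\tau$. For sets, $\mathrm{dist}(A,B)=\inf_{p\in A,\,q\in B}d(p,q)$, which is $+\infty$ if $A$ or $B$ is empty. For $\Omega\subseteq\mathbb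 H^n$ open, the derivatives $Z_iu$ and $Tu$ of $u\in L^1_{\mathrm{loc}}(\Omega)$ are taken in the sense of distributions, and $W^{2,s}_{\mathcal H}(\Omega)$ is the space of all $u\in L^s(\Omega)$ such that $Z_iu\in L^s(\Omega)$ and $Z_iZ_ju\in L^s(\Omega)$ for all $i,j\le 2n$. Put $\nabla^{\mathcal H}u=(Z_1u,\dots,Z_{2n}u)$ and $(\nabla^{2,\mathcal H}u)_{ij}=Z_iZ_ju$, and let $|\nabla^{2,\mathcal H}u|$ be the Euclidean operator norm of this matrix (the bound below then holds for the Frobenius norm too). **Theorem.** Let $s\in[1,\infty)$, let $\Omega\subseteq\mathbb H^n$ be open, let $f\in W^{2,s}_{\mathcal H}(\Omega)$, and let $A\subseteq\Omega$ be open with $\mathrm{dist}(A,\partial\Omega)>0$. Then $Tf\in L^s(\Omega)$, and for every $w\in\mathbb H^n$, $$\frac{f(p\cdot\delta_\varepsilon(w))-f(p)-\varepsilon\langle\nabla^{\mathcal H}f(p),w_{\mathcal H}\rangle}{\varepsilon^2}\;\longrightarrow\;\frac12\langle\nabla^{2,\mathcal H}f(p)\,w_{\mathcal H},w_{\mathcal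 H}\rangle+w_N\,Tf(p)$$ in $L^s(A)$, as functions of $p$, as $\varepsilon\searrow0$. Moreover, if $w\in\mathbb H^n$ and $\varepsilon>0$ satisfy $\varepsilon\bigl(|w_{\mathcal H}|+2\sqrt{|w_N|}\bigr)<\mathrm{dist}(A,\partial\Omega)$, then the difference quotient is in $L^s(A)$ and $$\left\|\frac{f(p\cdot\delta_\varepsilon(w))-f(p)-\varepsilon\langle\nabla^{\mathcal H}f(p),w_{\mathcal H}\rangle}{\varepsilon^2}\right\|_{L^s(A)}\le|w_N|\,\|Tf\|_{L^s(\Omega)}+|w_{\mathcal H}|^2\,\bigl\|\,|\nabla^{2,\mathcal H}f|\,\bigr\|_{L^s(\Omega)}.$$ -/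

import Mathlib

open MeasureTheory Filter Topology
open scoped ENNReal ContDiff

noncomputable section

/-- The underlying space `ℝ^{2n+1}` of the `n`-th Heisenberg group. A point is `p = (p.1, p.2)`,
where `p.1 = (x, y)` is the horizontal part (`x j = p.1 (Sum.inl j)`, `y j = p.1 (Sum.inr j)`, with
the Euclidean norm) and `p.2 = t` is the vertical part. The measure `volume` is Lebesgue measure. -/
abbrev Heis (n : ℕ) : Type := EuclideanSpace ℝ (Fin n ⊕ Fin n) × ℝ

namespace Heis

variable {n : ℕ}

/-- The group law
`(x, y, t) · (x', y', t') = (x + x', y + y', t + t' + 2 ∑ⱼ (x'ⱼ yⱼ - xⱼ y'ⱼ))`. -/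
def mul (p q : Heis n) : Heis n :=
  (p.1 + q.1, p.2 + q.2 + 2 * ∑ j : Fin n,
    (q.1 (Sum.inl j) * p.1 (Sum.inr j) - p.1 (Sum.inl j) * q.1 (Sum.inr j)))

/-- The intrinsic dilations `δ_r (x, y, t) = (r x, r y, r² t)`. -/
def dil (r : ℝ) (p : Heis n) : Heis n := (r • p.1, r ^ 2 * p.2)

/-- The left-invariant horizontal vector fields: `Z (inl j) = Xⱼ = ∂_{xⱼ} + 2 yⱼ ∂_t` and
`Z (inr j) = Yⱼ = ∂_{yⱼ} - 2 xⱼ ∂_t`. -/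
def Z : Fin n ⊕ Fin n → Heis n → Heis n
  | Sum.inl j, p => (EuclideanSpace.single (Sum.inl j) 1, 2 * p.1 (Sum.inr j))
  | Sum.inr j, p => (EuclideanSpace.single (Sum.inr j) 1, -2 * p.1 (Sum.inl j))

/-- The vertical vector field `T = ∂_t`. -/
def T : Heis n → Heis n := fun _ => (0, 1)

/-- `γ : [0, 1] → ℍⁿ` is an absolutely continuous horizontal curve: for almost every time the
velocity lies in the span of the `Xⱼ`, `Yⱼ` at the current point. -/
def IsHorizontalCurve (γ : ℝ → Heis n) : Prop :=
  AbsolutelyContinuousOnInterval γ 0 1 ∧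
    ∀ᵐ τ ∂(volume.restrict (Set.Icc (0 : ℝ) 1)),
      deriv γ τ ∈ Submodule.span ℝ (Set.range fun i => Z i (γ τ))

/-- The length of a horizontal curve for the metric that makes `X₁, …, Xₙ, Y₁, …, Yₙ, T`
orthonormal. The coefficients of a horizontal vector `∑ᵢ uᵢ Zᵢ` are the coordinates of its
horizontal part `u`, so its length is the Euclidean norm of that part. -/
def length (γ : ℝ → Heis n) : ℝ≥0∞ :=
  ∫⁻ τ in Set.Icc (0 : ℝ) 1, ‖(deriv γ τ).1‖ₑ

/-- The Carnot–Carathéodory distance. -/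
def ccDist (p q : Heis n) : ℝ≥0∞ :=
  ⨅ (γ : ℝ → Heis n) (_ : IsHorizontalCurve γ ∧ γ 0 = p ∧ γ 1 = q), length γ

/-- The distance between two sets for the Carnot–Carathéodory distance (`∞` if one is empty). -/
def ccSetDist (A B : Set (Heis n)) : ℝ≥0∞ := ⨅ (p ∈ A) (q ∈ B), ccDist p q

/-- `g` is the distributional derivative of `f` on `Ω` along the vector field `V`:
`∫_Ω f Vφ = - ∫_Ω g φ` for all `φ ∈ C_c^∞(Ω)`. It is used only for the fields `Z i` and `T`, which
have divergence zero. -/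
def HasWeakDeriv (Ω : Set (Heis n)) (V : Heis n → Heis n) (f g : Heis n → ℝ) : Prop :=
  LocallyIntegrableOn f Ω ∧ LocallyIntegrableOn g Ω ∧
    ∀ φ : Heis n → ℝ, ContDiff ℝ ∞ φ → HasCompactSupport φ → tsupport φ ⊆ Ω →
      ∫ p in Ω, f p * fderiv ℝ φ p (V p) = -∫ p in Ω, g p * φ p

open Classical in
/-- The distributional derivative of `f` on `Ω` along `V` (a representative, unique almost
everywhere on `Ω`) if it is a locally integrable function, and `0` otherwise. -/
def weakDeriv (Ω : Set (Heis n)) (V : Heis n → Heis n) (f : Heis n → ℝ) : Heis n → ℝ :=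
  if h : ∃ g, HasWeakDeriv Ω V f g then h.choose else 0

/-- The horizontal Sobolev space `W^{k,s}_H(Ω)`: all iterated distributional derivatives of `f`
along `X₁, …, Xₙ, Y₁, …, Yₙ` up to order `k` are in `L^s(Ω)`. -/
def MemSobolev (Ω : Set (Heis n)) (s : ℝ≥0∞) : ℕ → (Heis n → ℝ) → Prop
  | 0, f => MemLp f s (volume.restrict Ω)
  | k + 1, f => MemLp f s (volume.restrict Ω) ∧
      ∀ i, ∃ g, HasWeakDeriv Ω (Z i) f g ∧ MemSobolev Ω s k g

/-- The horizontal gradient `∇^H f = (X₁ f, …, Xₙ f, Y₁ f, …, Yₙ f)`. -/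
def hGrad (Ω : Set (Heis n)) (f : Heis n → ℝ) (p : Heis n) : EuclideanSpace ℝ (Fin n ⊕ Fin n) :=
  WithLp.toLp 2 fun i => weakDeriv Ω (Z i) f p

/-- The horizontal Hessian `(∇^{2,H} f)ᵢⱼ = Zᵢ Zⱼ f`, as a linear operator on `ℝ^{2n}`; its norm is
the operator norm for the Euclidean norm. -/
def hHess (Ω : Set (Heis n)) (f : Heis n → ℝ) (p : Heis n) :
    EuclideanSpace ℝ (Fin n ⊕ Fin n) →L[ℝ] EuclideanSpace ℝ (Fin n ⊕ Fin n) :=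
  Matrix.toEuclideanCLM (𝕜 := ℝ) (Matrix.of fun i j => weakDeriv Ω (Z i) (weakDeriv Ω (Z j) f) p)

/-- The second-order difference quotient
`(f(p · δ_ε w) - f(p) - ε ⟨∇^H f(p), w_H⟩) / ε²`. -/
def diffQuot₂ (Ω : Set (Heis n)) (f : Heis n → ℝ) (w : Heis n) (ε : ℝ) (p : Heis n) : ℝ :=
  (f (mul p (dil ε w)) - f p - ε * inner ℝ (hGrad Ω f p) w.1) / ε ^ 2

end Heis

end

/-!
The flow of a left-invariant vector field is right translation along a one-parameter subgroup. It
preserves the volume and the field, so moving it onto the test function in the definition of the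
distributional derivative turns the classical fundamental theorem of calculus into
`f(p · w) - f(p) = ∫₀¹ (Vf)(p · τw) dτ` for almost every `p`. By Minkowski's inequality, the `L^s`
norm of a Taylor remainder along the flow is then at most the supremum over `τ` of that of the
integrand.

Write `p · (u, t) = p · (u, 0) · (0, t)`. The horizontal factor contributes a second-order Taylor
expansion along `∑ᵢ uᵢ Zᵢ` and the vertical one a first-order expansion along `T`, which is a
derivative in `L^s` because `[Yⱼ, Xⱼ] = 4T`. The errors are moduli of continuity of translations
in `L^s` of the second derivatives, and these vanish in the limit. The path followed stays in `Ω`,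
because a commutator of four horizontal segments of length `√|t| / 2` produces the vertical
translation by `t`, whence `d(p, p · (u, 0) · (0, t)) ≤ |u| + 2√|t|`.
-/

lemma lipschitzWith_ite_le {X : Type*} [PseudoMetricSpace X] {f g : ℝ → X} {K : NNReal} {b : ℝ}
    (hf : LipschitzWith K f) (hg : LipschitzWith K g) (hfg : f b = g b) :
    LipschitzWith K fun τ => if τ ≤ b then f τ else g τ := by
  have across : ∀ x y : ℝ, x ≤ b → b ≤ y → dist (f x) (g y) ≤ K * dist x y := by
    intro x y hx hy
    calc dist (f x) (g y) ≤ dist (f x) (f b) + dist (g b) (g y) := hfg ▸ dist_triangle _ _ _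
      _ ≤ K * dist x b + K * dist b y := add_le_add (hf.dist_le_mul _ _) (hg.dist_le_mul _ _)
      _ = K * dist x y := by
          rw [Real.dist_eq, Real.dist_eq, Real.dist_eq, abs_of_nonpos (by linarith),
            abs_of_nonpos (by linarith), abs_of_nonpos (by linarith)]
          ring
  refine LipschitzWith.of_dist_le_mul fun x y => ?_
  split_ifs with hx hy hy
  · exact hf.dist_le_mul _ _
  · exact across x y hx (not_le.1 hy).le
  · rw [dist_comm, dist_comm x]
    exact across y x hy (not_le.1 hx).le
  · exact hg.dist_le_mul _ _

lemma restrict_Ioo_eq_add {a b c : ℝ} (hab : a ≤ b) (hbc : b ≤ c) :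
    (volume.restrict (Set.Ioo a c) : Measure ℝ) =
      volume.restrict (Set.Ioo a b) + volume.restrict (Set.Ioo b c) := by
  simp only [Measure.restrict_congr_set (μ := (volume : Measure ℝ)) Ioo_ae_eq_Ioc]
  rw [← Set.Ioc_union_Ioc_eq_Ioc hab hbc,
    Measure.restrict_union (Set.Ioc_disjoint_Ioc_of_le le_rfl) measurableSet_Ioc]

section Minkowski

variable {X Y E : Type*} [MeasurableSpace X] [MeasurableSpace Y] [NormedAddCommGroup E]
  [NormedSpace ℝ E] {μ : Measure X} [SFinite μ] {ν : Measure Y} [IsProbabilityMeasure ν]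
  {K : Y → X → E} {C : ℝ≥0∞}

lemma eLpNormEssSup_integral_le (hK : AEStronglyMeasurable (Function.uncurry K) (ν.prod μ))
    (hC : ∀ᵐ y ∂ν, eLpNormEssSup (K y) μ ≤ C) :
    eLpNormEssSup (fun x => ∫ y, K y x ∂ν) μ ≤ C := by
  have hexcess : ∫⁻ x, ∫⁻ y, (‖K y x‖ₑ - C) ∂ν ∂μ = 0 := by
    rw [← lintegral_lintegral_swap (hK.enorm.sub_const C)]
    refine lintegral_eq_zero_of_ae_eq_zero ?_
    filter_upwards [hC] with y hy
    refine lintegral_eq_zero_of_ae_eq_zero ?_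
    filter_upwards [enorm_ae_le_eLpNormEssSup (K y) μ] with x hx
    exact tsub_eq_zero_of_le (hx.trans hy)
  have hae := (lintegral_eq_zero_iff'
    (hK.enorm.sub_const C).prod_swap.lintegral_prod_right').1 hexcess
  refine eLpNormEssSup_le_of_ae_enorm_bound ?_
  filter_upwards [hae] with x hx
  calc ‖∫ y, K y x ∂ν‖ₑ ≤ ∫⁻ y, ‖K y x‖ₑ ∂ν := enorm_integral_le_lintegral_enorm _
    _ ≤ ∫⁻ y, (C + (‖K y x‖ₑ - C)) ∂ν := lintegral_mono fun y => le_add_tsub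
    _ = C := by
        rw [lintegral_add_left measurable_const, lintegral_const, measure_univ, mul_one]
        exact (congrArg (C + ·) hx).trans (add_zero C)

theorem eLpNorm_integral_le {s : ℝ≥0∞} (hs1 : 1 ≤ s)
    (hK : AEStronglyMeasurable (Function.uncurry K) (ν.prod μ))
    (hC : ∀ᵐ y ∂ν, eLpNorm (K y) s μ ≤ C) : eLpNorm (fun x => ∫ y, K y x ∂ν) s μ ≤ C := by
  rcases eq_or_ne s ⊤ with rfl | hs
  · simp only [eLpNorm_exponent_top] at hC ⊢
    exact eLpNormEssSup_integral_le hK hC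
  have hs0 : s ≠ 0 := (one_pos.trans_le hs1).ne'
  have hr : 0 < s.toReal := ENNReal.toReal_pos hs0 hs
  simp only [eLpNorm_eq_eLpNorm' hs0 hs] at hC ⊢
  rw [← ENNReal.rpow_le_rpow_iff hr, ← lintegral_rpow_enorm_eq_rpow_eLpNorm' hr]
  have jensen : ∀ᵐ x ∂μ, ‖∫ y, K y x ∂ν‖ₑ ≤ eLpNorm' (fun y => K y x) s.toReal ν := by
    filter_upwards [hK.prod_swap.prodMk_left] with x hx
    rw [← eLpNorm_eq_eLpNorm' hs0 hs]
    exact (enorm_integral_le_lintegral_enorm _).trans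
      (eLpNorm_one_eq_lintegral_enorm.symm.trans_le (eLpNorm_le_eLpNorm_of_exponent_le hs1 hx))
  calc ∫⁻ x, ‖∫ y, K y x ∂ν‖ₑ ^ s.toReal ∂μ
      ≤ ∫⁻ x, ∫⁻ y, ‖K y x‖ₑ ^ s.toReal ∂ν ∂μ := by
        refine lintegral_mono_ae (jensen.mono fun x hx => ?_)
        rw [lintegral_rpow_enorm_eq_rpow_eLpNorm' hr]
        gcongr
    _ = ∫⁻ y, ∫⁻ x, ‖K y x‖ₑ ^ s.toReal ∂μ ∂ν :=
        (lintegral_lintegral_swap (hK.enorm.pow_const _)).symm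
    _ ≤ ∫⁻ _, C ^ s.toReal ∂ν := by
        refine lintegral_mono_ae (hC.mono fun y hy => ?_)
        rw [lintegral_rpow_enorm_eq_rpow_eLpNorm' hr]
        gcongr
    _ = C ^ s.toReal := by simp

end Minkowski

lemma locallyIntegrableOn_sum {X E ι : Type*} [MeasurableSpace X] [TopologicalSpace X]
    [NormedAddCommGroup E] {μ : Measure X} {S : Set X} [Fintype ι] {g : ι → X → E}
    (h : ∀ i, LocallyIntegrableOn (g i) S μ) : LocallyIntegrableOn (fun x => ∑ i, g i x) S μ := by
  classical
  simp only [← Finset.sum_apply]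
  exact Finset.sum_induction g (LocallyIntegrableOn · S μ) (fun _ _ => .add)
    locallyIntegrableOn_zero fun i _ => h i

section CompactSupport

variable {X : Type*} [TopologicalSpace X] [MeasurableSpace X] {μ : Measure X} {S : Set X}
  {f ψ : X → ℝ}

lemma integrable_mul_of_tsupport_subset [T2Space X] [OpensMeasurableSpace X]
    (hf : LocallyIntegrableOn f S μ) (hψ : Continuous ψ) (hc : HasCompactSupport ψ)
    (hsub : tsupport ψ ⊆ S) : Integrable (fun x => f x * ψ x) μ := by
  have hint : IntegrableOn (fun x => f x * ψ x) (tsupport ψ) μ :=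
    (hf.integrableOn_compact_subset hsub hc).mul_continuousOn hψ.continuousOn hc
  exact (integrableOn_iff_integrable_of_support_subset fun x hx =>
    subset_tsupport ψ (right_ne_zero_of_mul hx)).1 hint

lemma setIntegral_mul_eq_integral (hsub : tsupport ψ ⊆ S) :
    ∫ x in S, f x * ψ x ∂μ = ∫ x, f x * ψ x ∂μ := by
  refine setIntegral_eq_integral_of_forall_compl_eq_zero fun x hx => ?_
  rw [image_eq_zero_of_notMem_tsupport fun h => hx (hsub h), mul_zero]

lemma tsupport_fderiv_apply_field_subset {E : Type*} [NormedAddCommGroup E] [NormedSpace ℝ E]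
    (φ : E → ℝ) (V : E → E) : tsupport (fun p => fderiv ℝ φ p (V p)) ⊆ tsupport φ := by
  refine (closure_mono fun p hp => ?_).trans (tsupport_fderiv_subset ℝ (f := φ))
  exact fun h => hp (by simp only [h, zero_apply])

end CompactSupport

section RealLp

lemma enorm_le_one_of_mem_Icc {τ : ℝ} (hτ : τ ∈ Set.Icc (0 : ℝ) 1) : ‖τ‖ₑ ≤ 1 := by
  rw [Real.enorm_of_nonneg hτ.1]
  exact ENNReal.ofReal_le_one.2 hτ.2

lemma enorm_mul_mul (b c : ℝ) (a : ℝ≥0∞) : ‖b * c‖ₑ * a = ‖b‖ₑ * (‖c‖ₑ * a) := by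
  rw [enorm_mul, mul_assoc]

variable {X : Type*} [MeasurableSpace X] {s : ℝ≥0∞}

lemma eLpNorm_const_mul (c : ℝ) (f : X → ℝ) (μ : Measure X) :
    eLpNorm (fun x => c * f x) s μ = ‖c‖ₑ * eLpNorm f s μ :=
  eLpNorm_const_smul c f s μ

lemma eLpNorm_inv_mul_le {c : ℝ} (hc : c ≠ 0) {μ : Measure X} {f : X → ℝ} {C : ℝ≥0∞}
    (hf : eLpNorm f s μ ≤ ‖c‖ₑ * C) : eLpNorm (fun x => c⁻¹ * f x) s μ ≤ C := by
  rw [eLpNorm_const_mul, enorm_inv hc]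
  exact (mul_le_mul_right hf _).trans_eq
    (ENNReal.inv_mul_cancel_left (by simpa using hc) enorm_ne_top)

end RealLp

noncomputable section

namespace Heis

variable {n : ℕ}

section GroupLaw

/-- The horizontal layer `ℝ^{2n}`. -/
abbrev Horizontal (n : ℕ) : Type := EuclideanSpace ℝ (Fin n ⊕ Fin n)

/-- The symplectic form `⟨(x, y), (x', y')⟩ ↦ ∑ⱼ (yⱼ x'ⱼ - xⱼ y'ⱼ)` of the group law. -/
def symp : Horizontal n →L[ℝ] Horizontal n →L[ℝ] ℝ :=
  ∑ j : Fin n,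
    ((EuclideanSpace.proj (Sum.inr j) : Horizontal n →L[ℝ] ℝ).smulRight
        (EuclideanSpace.proj (Sum.inl j) : Horizontal n →L[ℝ] ℝ) -
      (EuclideanSpace.proj (Sum.inl j) : Horizontal n →L[ℝ] ℝ).smulRight
        (EuclideanSpace.proj (Sum.inr j) : Horizontal n →L[ℝ] ℝ))

lemma symp_apply (u v : Horizontal n) :
    symp u v = ∑ j : Fin n,
      (u (Sum.inr j) * v (Sum.inl j) - u (Sum.inl j) * v (Sum.inr j)) := by
  simp [symp]

@[simp] lemma symp_self (u : Horizontal n) : symp u u = 0 := by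
  rw [symp_apply]
  exact Finset.sum_eq_zero fun _ _ => by ring

lemma symp_swap (u v : Horizontal n) : symp v u = -symp u v := by
  rw [symp_apply, symp_apply, ← Finset.sum_neg_distrib]
  exact Finset.sum_congr rfl fun _ _ => by ring

lemma symp_single_inr_inl (j : Fin n) (a b : ℝ) :
    symp (EuclideanSpace.single (Sum.inr j) a) (EuclideanSpace.single (Sum.inl j) b) = a * b := by
  simp [symp_apply]

lemma mul_eq (p q : Heis n) : mul p q = (p.1 + q.1, p.2 + q.2 + 2 * symp p.1 q.1) := by
  simp only [mul, symp_apply, mul_comm (p.1 (Sum.inr _))]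

@[simp] lemma mul_zero (p : Heis n) : mul p 0 = p := by
  simp [mul_eq]

protected lemma mul_assoc (p q r : Heis n) : mul (mul p q) r = mul p (mul q r) := by
  ext
  · simp [mul_eq, add_assoc]
  · simp only [mul_eq, map_add, add_apply]
    ring

lemma mul_smul_smul (w : Heis n) (a b : ℝ) : mul (a • w) (b • w) = (a + b) • w := by
  simp [mul_eq, add_smul, Prod.ext_iff]

lemma mul_horizontal_vertical (u : Horizontal n) (t : ℝ) :
    mul ((u, 0) : Heis n) (0, t) = (u, t) := by
  simp [mul_eq]

@[fun_prop]
lemma continuous_mul {X : Type*} [TopologicalSpace X] {f g : X → Heis n}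
    (hf : Continuous f) (hg : Continuous g) : Continuous fun x => mul (f x) (g x) := by
  simp only [mul_eq]
  fun_prop

/-- The left-invariant vector field `∑ᵢ wᵢ Zᵢ + w_N T`, whose flow is `τ ↦ p · (τ w)`. -/
def lvf (w p : Heis n) : Heis n := (w.1, w.2 + 2 * symp p.1 w.1)

lemma mul_eq_add_lvf (p w : Heis n) : mul p w = p + lvf w p := by
  simp [mul_eq, lvf, Prod.ext_iff, add_assoc]

lemma lvf_smul (c : ℝ) (w p : Heis n) : lvf (c • w) p = c • lvf w p := by
  ext
  · rfl
  · simp only [lvf, Prod.smul_fst, Prod.smul_snd, smul_eq_mul, map_smul]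
    ring

lemma mul_smul_eq_add (p w : Heis n) (τ : ℝ) : mul p (τ • w) = p + τ • lvf w p := by
  rw [mul_eq_add_lvf, lvf_smul]

lemma lvf_mul_smul (w p : Heis n) (τ : ℝ) : lvf w (mul p (τ • w)) = lvf w p := by
  simp [lvf, mul_eq]

@[fun_prop]
lemma contDiff_lvf (w : Heis n) {k : WithTop ℕ∞} : ContDiff ℝ k (lvf w) := by
  unfold lvf
  fun_prop

@[fun_prop]
lemma continuous_lvf (w : Heis n) : Continuous (lvf w) :=
  (contDiff_lvf w (k := 0)).continuous

lemma Z_eq_lvf (i : Fin n ⊕ Fin n) : Z i = lvf ((EuclideanSpace.single i 1, 0) : Heis n) := by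
  funext p
  cases i <;> simp [Z, lvf, symp_apply]

lemma T_eq_lvf : T = lvf ((0, 1) : Heis n) := by
  funext p
  simp [T, lvf]

lemma lvf_horizontal (u : Horizontal n) (p : Heis n) : lvf (u, 0) p = ∑ i, u i • Z i p := by
  ext i
  · cases i <;>
      simp [lvf, Z, Prod.fst_sum, Pi.single_apply, Finset.sum_ite_eq]
  · simp only [lvf, Z, symp_apply, Prod.snd_sum, Fintype.sum_sum_type, Prod.smul_mk, smul_eq_mul,
      Prod.mk_add_mk, Finset.mul_sum, zero_add, ← Finset.sum_add_distrib]
    exact Finset.sum_congr rfl fun _ _ => by ring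

/-- Right translation by `w`. -/
def mulRight (w : Heis n) : Heis n ≃ₜ Heis n where
  toFun p := mul p w
  invFun p := mul p (-w)
  left_inv p := by simpa [Heis.mul_assoc] using congrArg (mul p) (mul_smul_smul w 1 (-1))
  right_inv p := by simpa [Heis.mul_assoc] using congrArg (mul p) (mul_smul_smul w (-1) 1)
  continuous_toFun := by fun_prop
  continuous_invFun := by fun_prop

@[simp] lemma mulRight_apply (w p : Heis n) : mulRight w p = mul p w := rfl

lemma measurePreserving_mulRight (w : Heis n) : MeasurePreserving (mulRight w) := by
  have shear := (measurePreserving_add_right (volume : Measure (Horizontal n)) w.1).skew_product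
    (μc := (volume : Measure ℝ)) (μd := volume) (g := fun u t => t + (w.2 + 2 * symp u w.1))
    (Continuous.measurable (by simp only [Function.uncurry_def]; fun_prop))
    (ae_of_all _ fun _ => (measurePreserving_add_right (volume : Measure ℝ) _).map_eq)
  have heq : ⇑(mulRight w) = fun p => (p.1 + w.1, p.2 + (w.2 + 2 * symp p.1 w.1)) := by
    funext p
    simp only [mulRight_apply, mul_eq, add_assoc]
  exact heq ▸ shear

lemma integral_comp_mul (w : Heis n) (g : Heis n → ℝ) : ∫ p, g (mul p w) = ∫ p, g p :=
  (measurePreserving_mulRight w).integral_comp (mulRight w).measurableEmbedding g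

end GroupLaw

section CarnotCaratheodory

/-- There is a Lipschitz horizontal curve of length at most `L`, parametrized by `[a, b]`, from `p`
to `q`. -/
def Reaches (a b : ℝ) (p q : Heis n) (L : ℝ≥0∞) : Prop :=
  ∃ (γ : ℝ → Heis n) (K : NNReal), LipschitzWith K γ ∧ γ a = p ∧ γ b = q ∧
    (∀ᵐ τ ∂(volume.restrict (Set.Ioo a b)),
      deriv γ τ ∈ Submodule.span ℝ (Set.range fun i => Z i (γ τ))) ∧
    ∫⁻ τ in Set.Ioo a b, ‖(deriv γ τ).1‖ₑ ≤ L

lemma reaches_mul_horizontal {a b : ℝ} (hab : a < b) (p : Heis n) (v : Horizontal n) :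
    Reaches a b p (mul p (v, 0)) ‖v‖ₑ := by
  have hc : 0 < b - a := sub_pos.2 hab
  let σ : ℝ → Heis n := fun τ => mul p (((τ - a) / (b - a)) • ((v, 0) : Heis n))
  have hσ : ∀ τ, HasDerivAt σ ((b - a)⁻¹ • lvf (v, 0) (σ τ)) τ := fun τ => by
    have hlin : HasDerivAt (fun τ : ℝ => (τ - a) / (b - a)) (b - a)⁻¹ τ := by
      simpa using ((hasDerivAt_id τ).sub_const a).div_const (b - a)
    rw [lvf_mul_smul]
    simpa only [σ, mul_smul_eq_add] using (hlin.smul_const (lvf (v, 0) p)).const_add p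
  refine ⟨σ, ‖(b - a)⁻¹ • lvf (v, 0) p‖₊, ?_, ?_, ?_, ae_of_all _ fun τ => ?_, ?_⟩
  · exact lipschitzWith_of_nnnorm_deriv_le (fun τ => (hσ τ).differentiableAt)
      fun τ => by rw [(hσ τ).deriv, lvf_mul_smul]
  · simp only [σ, sub_self, zero_div, zero_smul, mul_zero]
  · simp only [σ, div_self hc.ne', one_smul]
  · rw [(hσ τ).deriv, lvf_horizontal]
    exact Submodule.smul_mem _ _ (Submodule.sum_mem _ fun i _ =>
      Submodule.smul_mem _ _ (Submodule.subset_span ⟨i, rfl⟩))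
  · have hspeed : ∀ τ, ‖(deriv σ τ).1‖ₑ = ENNReal.ofReal (b - a)⁻¹ * ‖v‖ₑ := fun τ => by
      rw [(hσ τ).deriv, Prod.smul_fst, enorm_smul, Real.enorm_of_nonneg (inv_nonneg.2 hc.le), lvf]
    simp_rw [hspeed]
    rw [setLIntegral_const, Real.volume_Ioo, mul_right_comm,
      ← ENNReal.ofReal_mul (inv_nonneg.2 hc.le), inv_mul_cancel₀ hc.ne', ENNReal.ofReal_one,
      one_mul]

lemma Reaches.trans {a b c : ℝ} (hab : a < b) (hbc : b < c) {p q r : Heis n} {L M : ℝ≥0∞}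
    (hpq : Reaches a b p q L) (hqr : Reaches b c q r M) : Reaches a c p r (L + M) := by
  obtain ⟨γ, K, hγ, hγa, hγb, hγhor, hγlen⟩ := hpq
  obtain ⟨σ, K', hσ, hσb, hσc, hσhor, hσlen⟩ := hqr
  let η : ℝ → Heis n := fun τ => if τ ≤ b then γ τ else σ τ
  have hleft : ∀ τ ∈ Set.Ioo a b, η =ᶠ[𝓝 τ] γ := fun τ hτ => by
    filter_upwards [Iio_mem_nhds hτ.2] with x hx using if_pos (le_of_lt hx)
  have hright : ∀ τ ∈ Set.Ioo b c, η =ᶠ[𝓝 τ] σ := fun τ hτ => by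
    filter_upwards [Ioi_mem_nhds hτ.1] with x hx using if_neg (not_le.2 hx)
  refine ⟨η, max K K', lipschitzWith_ite_le (hγ.weaken (le_max_left _ _))
    (hσ.weaken (le_max_right _ _)) (hγb.trans hσb.symm), ?_, ?_, ?_, ?_⟩
  · simp [η, hab.le, hγa]
  · simp [η, not_le.2 hbc, hσc]
  · rw [restrict_Ioo_eq_add hab.le hbc.le, ae_add_measure_iff]
    constructor
    · filter_upwards [hγhor, ae_restrict_mem measurableSet_Ioo] with τ hτ hmem
      rwa [(hleft τ hmem).deriv_eq, (hleft τ hmem).eq_of_nhds]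
    · filter_upwards [hσhor, ae_restrict_mem measurableSet_Ioo] with τ hτ hmem
      rwa [(hright τ hmem).deriv_eq, (hright τ hmem).eq_of_nhds]
  · rw [restrict_Ioo_eq_add hab.le hbc.le, lintegral_add_measure]
    refine add_le_add ?_ ?_
    · rwa [setLIntegral_congr_fun measurableSet_Ioo fun τ hτ => by rw [(hleft τ hτ).deriv_eq]]
    · rwa [setLIntegral_congr_fun measurableSet_Ioo fun τ hτ => by rw [(hright τ hτ).deriv_eq]]

lemma Reaches.ccDist_le {p q : Heis n} {L : ℝ≥0∞} (h : Reaches 0 1 p q L) : ccDist p q ≤ L := by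
  obtain ⟨γ, K, hγ, h0, h1, hhor, hlen⟩ := h
  rw [Measure.restrict_congr_set Ioo_ae_eq_Icc] at hhor hlen
  exact iInf₂_le_of_le γ ⟨⟨hγ.lipschitzOnWith.absolutelyContinuousOnInterval, hhor⟩, h0, h1⟩ hlen

lemma mul_commutator (p : Heis n) (u v : Horizontal n) :
    mul (mul (mul (mul p (u, 0)) (v, 0)) (-u, 0)) (-v, 0) = mul p (0, 4 * symp u v) := by
  simp only [mul_eq]
  refine Prod.ext (by dsimp only; abel) ?_
  simp only [map_add, map_neg, map_zero, add_apply, neg_apply, symp_self, symp_swap u v]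
  ring

lemma exists_symp_eq (hn : 1 ≤ n) (t : ℝ) :
    ∃ u v : Horizontal n, ‖u‖ = √|t| ∧ ‖v‖ = √|t| ∧ symp u v = t := by
  refine ⟨EuclideanSpace.single (Sum.inr ⟨0, hn⟩) √|t|,
    EuclideanSpace.single (Sum.inl ⟨0, hn⟩) (SignType.sign t * √|t|), by simp, ?_, ?_⟩
  · rcases eq_or_ne t 0 with rfl | ht
    · simp
    · rcases ht.lt_or_gt with ht | ht <;> simp [ht]
  · rw [symp_single_inr_inl, mul_left_comm, Real.mul_self_sqrt (abs_nonneg t), sign_mul_abs]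

lemma ccDist_mul_mul_le (hn : 1 ≤ n) (p : Heis n) (u : Horizontal n) (t : ℝ) :
    ccDist p (mul (mul p (u, 0)) (0, t)) ≤ ENNReal.ofReal (‖u‖ + 2 * √|t|) := by
  obtain ⟨v, w, hv, hw, hvw⟩ := exists_symp_eq hn (t / 4)
  have hsqrt : √|t / 4| = √|t| / 2 := by
    rw [abs_div, Real.sqrt_div (abs_nonneg t), abs_of_pos (four_pos (α := ℝ))]
    norm_num
  have hpath : Reaches 0 1 p (mul (mul p (u, 0)) (0, t))
      (‖u‖ₑ + ‖v‖ₑ + ‖w‖ₑ + ‖-v‖ₑ + ‖-w‖ₑ) := by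
    rw [← mul_div_cancel₀ t four_ne_zero, ← hvw, ← mul_commutator]
    have h₁ := reaches_mul_horizontal (a := 0) (b := 1 / 5) (by norm_num) p u
    have h₂ := h₁.trans (by norm_num) (by norm_num)
      (reaches_mul_horizontal (b := 2 / 5) (by norm_num) _ v)
    have h₃ := h₂.trans (by norm_num) (by norm_num)
      (reaches_mul_horizontal (b := 3 / 5) (by norm_num) _ w)
    have h₄ := h₃.trans (by norm_num) (by norm_num)
      (reaches_mul_horizontal (b := 4 / 5) (by norm_num) _ (-v))
    exact h₄.trans (by norm_num) (by norm_num) (reaches_mul_horizontal (by norm_num) _ (-w))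
  refine hpath.ccDist_le.trans_eq ?_
  simp only [← ofReal_norm, norm_neg, hv, hw, hsqrt]
  rw [← ENNReal.ofReal_add (by positivity) (by positivity),
    ← ENNReal.ofReal_add (by positivity) (by positivity),
    ← ENNReal.ofReal_add (by positivity) (by positivity),
    ← ENNReal.ofReal_add (by positivity) (by positivity)]
  ring_nf

lemma mem_of_ccDist_lt {A Ω : Set (Heis n)} (hΩ : IsOpen Ω) {p : Heis n} (hp : p ∈ A)
    {c : ℝ → Heis n} (hc : Continuous c) (h0 : c 0 ∈ Ω)
    (hlt : ∀ r ∈ Set.Icc (0 : ℝ) 1, ccDist p (c r) < ccSetDist A (frontier Ω)) :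
    ∀ r ∈ Set.Icc (0 : ℝ) 1, c r ∈ Ω := by
  have himage : c '' Set.Icc 0 1 ⊆ Ω := by
    refine (isPreconnected_Icc.image c hc.continuousOn).subset_of_closure_inter_subset hΩ
      ⟨c 0, Set.mem_image_of_mem c (by simp), h0⟩ ?_
    rintro _ ⟨hcl, r, hr, rfl⟩
    by_contra hr'
    have hfrontier : c r ∈ frontier Ω := hΩ.frontier_eq ▸ ⟨hcl, hr'⟩
    exact (hlt r hr).not_ge (iInf₂_le_of_le p hp (iInf₂_le _ hfrontier))
  exact fun r hr => himage ⟨r, hr, rfl⟩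

end CarnotCaratheodory

section Translations

lemma tendsto_eLpNorm_mul_sub {s : ℝ≥0∞} (hs1 : 1 ≤ s) (hs : s ≠ ⊤) {F : Heis n → ℝ}
    (hF : MemLp F s) :
    Tendsto (fun q : Heis n => eLpNorm (fun p => F (mul p q) - F p) s) (𝓝 0) (𝓝 0) := by
  have : Fact (1 ≤ s) := ⟨hs1⟩
  let R : Heis n → C(Heis n, Heis n) := fun q => ⟨mulRight q, (mulRight q).continuous⟩
  have hR : Continuous R := ContinuousMap.continuous_of_continuous_uncurry _ (by
    simp only [R, Function.uncurry_def, ContinuousMap.coe_mk, mulRight_apply]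
    fun_prop)
  have hcont : Continuous fun q =>
      ‖Lp.compMeasurePreserving (R q) (measurePreserving_mulRight q) (hF.toLp F) - hF.toLp F‖ₑ :=
    ((continuous_const.compMeasurePreservingLp hR measurePreserving_mulRight hs).sub
      continuous_const).enorm
  have heq : ∀ q, ‖Lp.compMeasurePreserving (R q) (measurePreserving_mulRight q) (hF.toLp F) -
      hF.toLp F‖ₑ = eLpNorm (fun p => F (mul p q) - F p) s := fun q => by
    rw [Lp.toLp_compMeasurePreserving, ← MemLp.toLp_sub, Lp.enorm_toLp]
    rfl
  simp only [heq] at hcont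
  exact hcont.tendsto' 0 0 (by simp)

lemma measurePreserving_prod_mul_smul (ν : Measure ℝ) [SFinite ν] (w : Heis n) :
    MeasurePreserving (fun z : ℝ × Heis n => (z.1, mul z.2 (z.1 • w))) (ν.prod volume)
      (ν.prod volume) :=
  (MeasurePreserving.id ν).skew_product (g := fun τ p => mul p (τ • w))
    (Continuous.measurable (by simp only [Function.uncurry_def]; fun_prop))
    (ae_of_all _ fun τ => (measurePreserving_mulRight (τ • w)).map_eq)

end Translations

section WeakDerivatives

variable {Ω : Set (Heis n)} {V W : Heis n → Heis n} {f f' g g' φ : Heis n → ℝ}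

/-- `φ ∈ C_c^∞(Ω)`. -/
structure IsTestFunction (Ω : Set (Heis n)) (φ : Heis n → ℝ) : Prop where
  contDiff : ContDiff ℝ ∞ φ
  hasCompactSupport : HasCompactSupport φ
  tsupport_subset : tsupport φ ⊆ Ω

namespace IsTestFunction

lemma integrable_mul (hφ : IsTestFunction Ω φ) (hf : LocallyIntegrableOn f Ω) :
    Integrable fun p => f p * φ p :=
  integrable_mul_of_tsupport_subset hf hφ.contDiff.continuous hφ.hasCompactSupport
    hφ.tsupport_subset

lemma integrable_mul_fderiv (hφ : IsTestFunction Ω φ) (hf : LocallyIntegrableOn f Ω)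
    (hV : Continuous V) : Integrable fun p => f p * fderiv ℝ φ p (V p) := by
  have hsub := tsupport_fderiv_apply_field_subset φ V
  exact integrable_mul_of_tsupport_subset hf
    ((hφ.contDiff.continuous_fderiv (by simp)).clm_apply hV)
    (hφ.hasCompactSupport.of_isClosed_subset (isClosed_tsupport _) hsub)
    (hsub.trans hφ.tsupport_subset)

lemma fderiv_apply (hφ : IsTestFunction Ω φ) (hV : ContDiff ℝ ∞ V) :
    IsTestFunction Ω fun p => fderiv ℝ φ p (V p) where
  contDiff := (hφ.contDiff.fderiv_right le_rfl).clm_apply hV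
  hasCompactSupport := hφ.hasCompactSupport.of_isClosed_subset (isClosed_tsupport _)
    (tsupport_fderiv_apply_field_subset φ V)
  tsupport_subset := (tsupport_fderiv_apply_field_subset φ V).trans hφ.tsupport_subset

end IsTestFunction

lemma hasWeakDeriv_iff : HasWeakDeriv Ω V f g ↔
    LocallyIntegrableOn f Ω ∧ LocallyIntegrableOn g Ω ∧
      ∀ φ, IsTestFunction Ω φ → ∫ p, f p * fderiv ℝ φ p (V p) = -∫ p, g p * φ p := by
  refine and_congr_right fun _ => and_congr_right fun _ =>
    ⟨fun h φ hφ => ?_, fun h φ hφ hc hsub => ?_⟩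
  · rw [← setIntegral_mul_eq_integral hφ.tsupport_subset, ← setIntegral_mul_eq_integral
      ((tsupport_fderiv_apply_field_subset φ V).trans hφ.tsupport_subset)]
    exact h φ hφ.contDiff hφ.hasCompactSupport hφ.tsupport_subset
  · rw [setIntegral_mul_eq_integral hsub,
      setIntegral_mul_eq_integral ((tsupport_fderiv_apply_field_subset φ V).trans hsub)]
    exact h φ ⟨hφ, hc, hsub⟩

namespace HasWeakDeriv

lemma integral_eq (h : HasWeakDeriv Ω V f g) (hφ : IsTestFunction Ω φ) :
    ∫ p, f p * fderiv ℝ φ p (V p) = -∫ p, g p * φ p :=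
  (hasWeakDeriv_iff.1 h).2.2 φ hφ

lemma congr_ae (h : HasWeakDeriv Ω V f g) (hf : f =ᵐ[volume.restrict Ω] f')
    (hg : g =ᵐ[volume.restrict Ω] g') : HasWeakDeriv Ω V f' g' := by
  refine ⟨h.1.congr hf, h.2.1.congr hg, fun φ hφ hc hsub => ?_⟩
  have hleft := integral_congr_ae (hf.mul (ae_eq_refl fun p => fderiv ℝ φ p (V p)))
  have hright := integral_congr_ae (hg.mul (ae_eq_refl φ))
  exact hleft.symm.trans ((h.2.2 φ hφ hc hsub).trans (congrArg Neg.neg hright))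

lemma ae_eq (hΩ : IsOpen Ω) (h : HasWeakDeriv Ω V f g) (h' : HasWeakDeriv Ω V f g') :
    g =ᵐ[volume.restrict Ω] g' := by
  refine (ae_restrict_iff' hΩ.measurableSet).2 ?_
  have hzero := hΩ.ae_eq_zero_of_integral_contDiff_smul_eq_zero (μ := volume)
    (f := fun p => g p - g' p) (h.2.1.sub h'.2.1) fun φ hφ hc hsub => ?_
  · filter_upwards [hzero] with p hp hpΩ using sub_eq_zero.1 (hp hpΩ)
  · have hφ : IsTestFunction Ω φ := ⟨hφ, hc, hsub⟩
    simp only [smul_eq_mul, mul_comm (φ _), sub_mul]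
    rw [integral_sub (hφ.integrable_mul h.2.1) (hφ.integrable_mul h'.2.1), sub_eq_zero,
      ← neg_inj, ← h.integral_eq hφ, ← h'.integral_eq hφ]

lemma weakDeriv (h : HasWeakDeriv Ω V f g) : HasWeakDeriv Ω V f (weakDeriv Ω V f) := by
  have hex : ∃ g, HasWeakDeriv Ω V f g := ⟨g, h⟩
  rw [Heis.weakDeriv, dif_pos hex]
  exact hex.choose_spec

lemma smul_field (h : HasWeakDeriv Ω V f g) (c : ℝ) :
    HasWeakDeriv Ω (fun p => c • V p) f fun p => c * g p := by
  refine hasWeakDeriv_iff.2 ⟨h.1, h.2.1.smul c, fun φ hφ => ?_⟩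
  simp only [map_smul, smul_eq_mul, mul_left_comm _ c, mul_assoc, integral_const_mul,
    h.integral_eq hφ, mul_neg]

lemma smul (h : HasWeakDeriv Ω V f g) (c : ℝ) :
    HasWeakDeriv Ω V (fun p => c * f p) fun p => c * g p := by
  refine hasWeakDeriv_iff.2 ⟨h.1.smul c, h.2.1.smul c, fun φ hφ => ?_⟩
  simp only [mul_assoc, integral_const_mul, h.integral_eq hφ, mul_neg]

lemma sum_field {ι : Type*} [Fintype ι] {V : ι → Heis n → Heis n} {g : ι → Heis n → ℝ}
    (hf : LocallyIntegrableOn f Ω) (hV : ∀ i, Continuous (V i))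
    (h : ∀ i, HasWeakDeriv Ω (V i) f (g i)) :
    HasWeakDeriv Ω (fun p => ∑ i, V i p) f fun p => ∑ i, g i p := by
  refine hasWeakDeriv_iff.2 ⟨hf, locallyIntegrableOn_sum fun i => (h i).2.1, fun φ hφ => ?_⟩
  simp only [map_sum, Finset.mul_sum, Finset.sum_mul]
  rw [integral_finsetSum _ fun i _ => hφ.integrable_mul_fderiv hf (hV i),
    integral_finsetSum _ fun i _ => hφ.integrable_mul (h i).2.1]
  simp only [(h _).integral_eq hφ, Finset.sum_neg_distrib]

lemma sum {ι : Type*} [Fintype ι] {f g : ι → Heis n → ℝ} (hV : Continuous V)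
    (h : ∀ i, HasWeakDeriv Ω V (f i) (g i)) :
    HasWeakDeriv Ω V (fun p => ∑ i, f i p) fun p => ∑ i, g i p := by
  refine hasWeakDeriv_iff.2 ⟨locallyIntegrableOn_sum fun i => (h i).1,
    locallyIntegrableOn_sum fun i => (h i).2.1, fun φ hφ => ?_⟩
  simp only [Finset.sum_mul]
  rw [integral_finsetSum _ fun i _ => hφ.integrable_mul_fderiv (h i).1 hV,
    integral_finsetSum _ fun i _ => hφ.integrable_mul (h i).2.1]
  simp only [(h _).integral_eq hφ, Finset.sum_neg_distrib]

lemma lieBracket {h₁ h₂ : Heis n → ℝ} (hV : ContDiff ℝ ∞ V) (hW : ContDiff ℝ ∞ W)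
    (hVf : HasWeakDeriv Ω V f g) (hWf : HasWeakDeriv Ω W f g') (hWg : HasWeakDeriv Ω W g h₁)
    (hVg' : HasWeakDeriv Ω V g' h₂) :
    HasWeakDeriv Ω (VectorField.lieBracket ℝ V W) f fun p => h₂ p - h₁ p := by
  refine hasWeakDeriv_iff.2 ⟨hVf.1, hVg'.2.1.sub hWg.2.1, fun φ hφ => ?_⟩
  have hVφ := hφ.fderiv_apply hV
  have hWφ := hφ.fderiv_apply hW
  have hbracket : ∀ p, fderiv ℝ φ p (VectorField.lieBracket ℝ V W p) =
      fderiv ℝ (fun q => fderiv ℝ φ q (W q)) p (V p) -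
        fderiv ℝ (fun q => fderiv ℝ φ q (V q)) p (W p) := fun p =>
    VectorField.fderiv_apply_lieBracket hφ.contDiff.contDiffAt
      (minSmoothness_of_isRCLikeNormedField.trans_le ENat.LEInfty.out)
      (hW.differentiable (by simp) p) (hV.differentiable (by simp) p)
  simp only [hbracket, mul_sub, sub_mul]
  rw [integral_sub (hWφ.integrable_mul_fderiv hVf.1 hV.continuous)
      (hVφ.integrable_mul_fderiv hVf.1 hW.continuous), hVf.integral_eq hWφ, hWf.integral_eq hVφ,
    hWg.integral_eq hφ, hVg'.integral_eq hφ,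
    integral_sub (hφ.integrable_mul hVg'.2.1) (hφ.integrable_mul hWg.2.1)]
  ring

end HasWeakDeriv

lemma fderiv_lvf (w p u : Heis n) : fderiv ℝ (lvf w) p u = (0, 2 * symp u.1 w.1) := by
  have haffine : lvf w = fun p => w + ((0 : Heis n →L[ℝ] Horizontal n).prod
      ((2 : ℝ) • (symp.flip w.1).comp (ContinuousLinearMap.fst ℝ _ _))) p := by
    funext p
    simp [lvf, Prod.ext_iff]
  rw [haffine, fderiv_const_add, ContinuousLinearMap.fderiv]
  simp

lemma lieBracket_lvf (v w : Heis n) :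
    VectorField.lieBracket ℝ (lvf v) (lvf w) = lvf (0, 4 * symp v.1 w.1) := by
  funext p
  simp only [VectorField.lieBracket, fderiv_lvf, lvf, symp_swap v.1 w.1, map_zero]
  refine Prod.ext (by simp) ?_
  simp only [Prod.snd_sub]
  ring

lemma hasWeakDeriv_lvf_horizontal {g : Fin n ⊕ Fin n → Heis n → ℝ} (hf : LocallyIntegrableOn f Ω)
    (h : ∀ i, HasWeakDeriv Ω (Z i) f (g i)) (u : Horizontal n) :
    HasWeakDeriv Ω (lvf (u, 0)) f fun p => ∑ i, u i * g i p := by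
  rw [show lvf (u, 0) = fun p => ∑ i, u i • Z i p from funext (lvf_horizontal u)]
  exact .sum_field hf (fun i => by rw [Z_eq_lvf]; fun_prop)
    fun i => (h i).smul_field (u i)

lemma hasWeakDeriv_T (j : Fin n) {g₁ g₂ h₁ h₂ : Heis n → ℝ}
    (hX : HasWeakDeriv Ω (Z (Sum.inl j)) f g₁) (hY : HasWeakDeriv Ω (Z (Sum.inr j)) f g₂)
    (hYX : HasWeakDeriv Ω (Z (Sum.inr j)) g₁ h₁) (hXY : HasWeakDeriv Ω (Z (Sum.inl j)) g₂ h₂) :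
    HasWeakDeriv Ω T f fun p => 4⁻¹ * (h₁ p - h₂ p) := by
  rw [Z_eq_lvf] at hX hY hYX hXY
  have hbracket := (HasWeakDeriv.lieBracket (contDiff_lvf _) (contDiff_lvf _) hY hX hXY
    hYX).smul_field 4⁻¹
  convert hbracket using 1
  funext p
  rw [lieBracket_lvf, ← lvf_smul, T_eq_lvf]
  simp [symp_single_inr_inl]

end WeakDerivatives

section FlowAverage

variable {Ω B : Set (Heis n)} {w : Heis n} {F G φ : Heis n → ℝ}

/-- The points from which the flow of `lvf w` stays in `Ω` for the times in `[0, 1]`. -/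
def flowCore (Ω : Set (Heis n)) (w : Heis n) : Set (Heis n) :=
  {p | ∀ τ ∈ Set.Icc (0 : ℝ) 1, mul p (τ • w) ∈ Ω}

/-- The average of `G` along the flow of `lvf w` for the times in `[0, 1]`. -/
def flowAverage (w : Heis n) (G : Heis n → ℝ) (p : Heis n) : ℝ :=
  ∫ τ in Set.Icc (0 : ℝ) 1, G (mul p (τ • w))

lemma flowCore_subset : flowCore Ω w ⊆ Ω := fun p hp => by
  simpa using hp 0 (Set.left_mem_Icc.2 zero_le_one)

lemma flowCore_subset_preimage_mulRight_smul {τ : ℝ} (hτ : τ ∈ Set.Icc (0 : ℝ) 1) :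
    flowCore Ω w ⊆ mulRight (τ • w) ⁻¹' Ω := fun _ hp => hp τ hτ

lemma flowCore_subset_preimage_mulRight : flowCore Ω w ⊆ mulRight w ⁻¹' Ω := by
  simpa using flowCore_subset_preimage_mulRight_smul (Set.right_mem_Icc.2 zero_le_one)

lemma isOpen_flowCore (hΩ : IsOpen Ω) : IsOpen (flowCore Ω w) := by
  let orbit : C(Heis n, C(ℝ, Heis n)) :=
    ContinuousMap.curry ⟨fun z : Heis n × ℝ => mul z.1 (z.2 • w), by fun_prop⟩
  exact (ContinuousMap.isOpen_setOfPred_mapsTo isCompact_Icc hΩ).preimage orbit.continuous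

lemma mul_smul_mul_smul_neg (p w : Heis n) (τ : ℝ) :
    mul (mul p (τ • w)) (τ • -w) = p := by
  rw [Heis.mul_assoc, smul_neg, ← neg_smul, mul_smul_smul]
  simp

lemma mul_smul_neg_mul_smul (p w : Heis n) (τ : ℝ) :
    mul (mul p (τ • -w)) (τ • w) = p := by
  simpa using mul_smul_mul_smul_neg p (-w) τ

lemma lvf_mul_smul_neg (w p : Heis n) (τ : ℝ) : lvf w (mul p (τ • -w)) = lvf w p := by
  simpa using lvf_mul_smul w p (-τ)

lemma map_prod_restrict_flowCore_le (hB : MeasurableSet B) :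
    ((volume.restrict (Set.Icc (0 : ℝ) 1)).prod (volume.restrict (flowCore B w))).map
        (fun z => (z.1, mul z.2 (z.1 • w))) ≤
      (volume.restrict (Set.Icc (0 : ℝ) 1)).prod (volume.restrict B) := by
  have hmp := (measurePreserving_prod_mul_smul volume w).restrict_preimage
    ((measurableSet_Icc (a := (0 : ℝ)) (b := 1)).prod hB)
  have hsub : Set.Icc (0 : ℝ) 1 ×ˢ flowCore B w ⊆
      (fun z : ℝ × Heis n => (z.1, mul z.2 (z.1 • w))) ⁻¹' Set.Icc (0 : ℝ) 1 ×ˢ B :=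
    fun z hz => Set.mk_mem_prod hz.1 (hz.2 z.1 hz.1)
  rw [Measure.prod_restrict, Measure.prod_restrict, ← hmp.map_eq]
  exact Measure.map_mono (Measure.restrict_mono hsub le_rfl) hmp.measurable

lemma aestronglyMeasurable_comp_mul_smul (hB : MeasurableSet B)
    (hG : AEStronglyMeasurable G (volume.restrict B)) :
    AEStronglyMeasurable (Function.uncurry fun (τ : ℝ) p => G (mul p (τ • w)))
      ((volume.restrict (Set.Icc (0 : ℝ) 1)).prod (volume.restrict (flowCore B w))) :=
  (hG.comp_snd.mono_measure (map_prod_restrict_flowCore_le hB)).comp_measurable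
    (measurePreserving_prod_mul_smul volume w).measurable

lemma integrable_comp_mul_smul {K : Set (Heis n)} (hG : LocallyIntegrableOn G Ω)
    (hK : IsCompact K) (hKΩ : K ⊆ flowCore Ω w) :
    Integrable (fun z : ℝ × Heis n => G (mul z.2 (z.1 • w)))
      ((volume.restrict (Set.Icc (0 : ℝ) 1)).prod (volume.restrict K)) := by
  set L : Set (Heis n) := (fun z : ℝ × Heis n => mul z.2 (z.1 • w)) '' (Set.Icc (0 : ℝ) 1 ×ˢ K)
  have hL : IsCompact L := (isCompact_Icc.prod hK).image (by fun_prop)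
  have hLΩ : L ⊆ Ω := Set.image_subset_iff.2 fun z hz => hKΩ hz.2 z.1 hz.1
  have hKL : K ⊆ flowCore L w := fun p hp τ hτ => ⟨(τ, p), ⟨hτ, hp⟩, rfl⟩
  have hGL : Integrable G (volume.restrict L) := hG.integrableOn_compact_subset hLΩ hL
  have hcomp := ((hGL.comp_snd _).mono_measure
    (map_prod_restrict_flowCore_le (w := w) hL.measurableSet)).comp_measurable
      (measurePreserving_prod_mul_smul volume w).measurable
  exact hcomp.mono_measure (Measure.prod_mono le_rfl (Measure.restrict_mono hKL le_rfl))

lemma locallyIntegrableOn_flowAverage (hΩ : IsOpen Ω) (hG : LocallyIntegrableOn G Ω) :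
    LocallyIntegrableOn (flowAverage w G) (flowCore Ω w) :=
  (locallyIntegrableOn_iff (isOpen_flowCore hΩ).isLocallyClosed).2 fun _ hKΩ hK =>
    (integrable_comp_mul_smul hG hK hKΩ).integral_prod_right

lemma integrable_comp_mul_smul_mul (hG : LocallyIntegrableOn G Ω) {ψ : Heis n → ℝ}
    (hψ : Continuous ψ) (hc : HasCompactSupport ψ) (hsub : tsupport ψ ⊆ flowCore Ω w) :
    Integrable (fun z : ℝ × Heis n => G (mul z.2 (z.1 • w)) * ψ z.2)
      ((volume.restrict (Set.Icc (0 : ℝ) 1)).prod volume) := by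
  obtain ⟨C, hC⟩ := hc.exists_bound_of_continuous hψ
  have hint := (integrable_comp_mul_smul hG hc hsub).mul_bdd
    (hψ.comp_aestronglyMeasurable measurable_snd.aestronglyMeasurable) (ae_of_all _ fun z => hC z.2)
  rw [Measure.prod_restrict] at hint
  rw [← Measure.restrict_univ (μ := (volume : Measure (Heis n))), Measure.prod_restrict]
  refine IntegrableOn.of_forall_sdiff_eq_zero hint (measurableSet_Icc.prod .univ) fun z hz => ?_
  rw [image_eq_zero_of_notMem_tsupport fun h => hz.2 ⟨hz.1.1, h⟩, MulZeroClass.mul_zero]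

lemma integral_comp_mul_mul (w : Heis n) (F ψ : Heis n → ℝ) (τ : ℝ) :
    ∫ p, F (mul p (τ • w)) * ψ p = ∫ p, F p * ψ (mul p (τ • -w)) := by
  rw [← integral_comp_mul (τ • w) fun p => F p * ψ (mul p (τ • -w))]
  simp only [mul_smul_mul_smul_neg]

lemma contDiff_mul_right (v : Heis n) {k : WithTop ℕ∞} : ContDiff ℝ k fun p => mul p v := by
  simp only [mul_eq_add_lvf]
  fun_prop

lemma hasDerivAt_comp_mul_smul (hφ : Differentiable ℝ φ) (w p : Heis n) (τ : ℝ) :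
    HasDerivAt (fun σ : ℝ => φ (mul p (σ • w))) (fderiv ℝ φ (mul p (τ • w)) (lvf w p)) τ := by
  have horbit : HasDerivAt (fun σ : ℝ => mul p (σ • w)) (lvf w p) τ := by
    simp only [mul_smul_eq_add]
    simpa using ((hasDerivAt_id τ).smul_const (lvf w p)).const_add p
  exact hφ.differentiableAt.hasFDerivAt.comp_hasDerivAt τ horbit

lemma fderiv_comp_mul_smul (hφ : Differentiable ℝ φ) (w p : Heis n) (τ : ℝ) :
    fderiv ℝ (fun q => φ (mul q (τ • w))) p (lvf w p) =
      fderiv ℝ φ (mul p (τ • w)) (lvf w p) := by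
  have hleft := hasDerivAt_comp_mul_smul
    (hφ.comp ((contDiff_mul_right (τ • w)).differentiable one_ne_zero)) w p 0
  have hright := HasDerivAt.comp_add_const 0 τ (f := fun σ : ℝ => φ (mul p (σ • w)))
    (hasDerivAt_comp_mul_smul hφ w p _)
  simp only [Function.comp_def, Heis.mul_assoc, mul_smul_smul] at hleft
  simpa using hleft.unique hright

lemma sub_comp_mul_neg_eq_integral (hφ : ContDiff ℝ 1 φ) (w p : Heis n) :
    φ p - φ (mul p (-w)) =
      ∫ τ in Set.Icc (0 : ℝ) 1, fderiv ℝ φ (mul p (τ • -w)) (lvf w (mul p (τ • -w))) := by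
  have hderiv : ∀ τ ∈ Set.uIcc (0 : ℝ) 1, HasDerivAt (fun σ : ℝ => φ (mul p (σ • -w)))
      (-fderiv ℝ φ (mul p (τ • -w)) (lvf w (mul p (τ • -w)))) τ := fun τ _ => by
    have hfield : lvf w (mul p (τ • -w)) = -lvf (-w) p := by
      rw [lvf_mul_smul_neg, ← neg_one_smul ℝ w, lvf_smul, neg_one_smul, neg_neg]
    rw [hfield, map_neg, neg_neg]
    exact hasDerivAt_comp_mul_smul (hφ.differentiable one_ne_zero) (-w) p τ
  have hcont : Continuous fun τ : ℝ => fderiv ℝ φ (mul p (τ • -w)) (lvf w (mul p (τ • -w))) :=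
    ((hφ.continuous_fderiv one_ne_zero).comp (by fun_prop)).clm_apply (by fun_prop)
  have hFTC := intervalIntegral.integral_eq_sub_of_hasDerivAt hderiv
    (hcont.neg.intervalIntegrable 0 1)
  rw [integral_Icc_eq_integral_Ioc, ← intervalIntegral.integral_of_le zero_le_one, ← neg_inj,
    ← intervalIntegral.integral_neg, hFTC]
  simp

lemma IsTestFunction.comp_mulRight (hφ : IsTestFunction (flowCore Ω w) φ) {τ : ℝ}
    (hτ : τ ∈ Set.Icc (0 : ℝ) 1) : IsTestFunction Ω (φ ∘ mulRight (τ • -w)) where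
  contDiff := hφ.contDiff.comp (contDiff_mul_right _)
  hasCompactSupport := hφ.hasCompactSupport.comp_homeomorph _
  tsupport_subset := by
    rw [tsupport_comp_eq_preimage φ (mulRight (τ • -w))]
    intro p hp
    simpa only [mulRight_apply, mul_smul_neg_mul_smul] using hφ.tsupport_subset hp τ hτ

lemma locallyIntegrableOn_comp_mulRight (hΩ : IsOpen Ω) (hF : LocallyIntegrableOn F Ω)
    (w : Heis n) : LocallyIntegrableOn (F ∘ mulRight w) (mulRight w ⁻¹' Ω) := by
  refine (locallyIntegrableOn_iff
    (hΩ.preimage (mulRight w).continuous).isLocallyClosed).2 fun K hKΩ hK => ?_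
  have hint : IntegrableOn F (mulRight w '' K) := hF.integrableOn_compact_subset
    (Set.image_subset_iff.2 hKΩ) (hK.image (mulRight w).continuous)
  rw [← Set.preimage_image_eq K (mulRight w).injective]
  exact ((measurePreserving_mulRight w).integrableOn_comp_preimage
    (mulRight w).measurableEmbedding).2 hint

lemma integral_sub_mul_eq_neg_integral (hΩ : IsOpen Ω) (hF : LocallyIntegrableOn F Ω)
    (hφ : IsTestFunction (flowCore Ω w) φ) :
    ∫ p, (F (mul p w) - F p) * φ p = -∫ p, F p * (φ p - φ (mul p (-w))) := by
  have hφw : IsTestFunction Ω fun p => φ (mul p (-w)) := by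
    simpa [Function.comp_def] using hφ.comp_mulRight (τ := 1) (by simp)
  have hφΩ : IsTestFunction Ω φ :=
    ⟨hφ.contDiff, hφ.hasCompactSupport, hφ.tsupport_subset.trans flowCore_subset⟩
  have htranslate : Integrable fun p => F (mul p w) * φ p := hφ.integrable_mul
    ((locallyIntegrableOn_comp_mulRight hΩ hF w).mono_set flowCore_subset_preimage_mulRight)
  have hchange : ∫ p, F (mul p w) * φ p = ∫ p, F p * φ (mul p (-w)) := by
    simpa using integral_comp_mul_mul w F φ 1
  simp only [sub_mul, mul_sub]
  rw [integral_sub htranslate (hφΩ.integrable_mul hF),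
    integral_sub (hφΩ.integrable_mul hF) (hφw.integrable_mul hF), hchange]
  ring

namespace HasWeakDeriv

/-- The flow of `lvf w` preserves both the volume and `lvf w`. -/
lemma integral_comp_mul_smul (h : HasWeakDeriv Ω (lvf w) F G)
    (hφ : IsTestFunction (flowCore Ω w) φ) {τ : ℝ} (hτ : τ ∈ Set.Icc (0 : ℝ) 1) :
    ∫ p, F p * fderiv ℝ φ (mul p (τ • -w)) (lvf w (mul p (τ • -w))) =
      -∫ p, G (mul p (τ • w)) * φ p := by
  rw [integral_comp_mul_mul w G]
  refine Eq.trans (integral_congr_ae (ae_of_all _ fun p => ?_))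
    (h.integral_eq (hφ.comp_mulRight hτ))
  have hfield := fderiv_comp_mul_smul (hφ.contDiff.differentiable (by simp)) w p (-τ)
  rw [neg_smul, ← smul_neg] at hfield
  exact congrArg (F p * ·) ((congrArg _ (lvf_mul_smul_neg w p τ)).trans hfield.symm)

lemma integral_mul_sub_comp_eq (h : HasWeakDeriv Ω (lvf w) F G)
    (hφ : IsTestFunction (flowCore Ω w) φ) :
    ∫ p, F p * (φ p - φ (mul p (-w))) = -∫ p, flowAverage w G p * φ p := by
  have hVφ := hφ.fderiv_apply (contDiff_lvf w)
  have hintF := (measurePreserving_prod_mul_smul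
    (volume.restrict (Set.Icc (0 : ℝ) 1)) (-w)).integrable_comp_of_integrable
      (integrable_comp_mul_smul_mul h.1 hVφ.contDiff.continuous hVφ.hasCompactSupport
        hVφ.tsupport_subset)
  simp only [Function.comp_def, mul_smul_neg_mul_smul] at hintF
  have hintG := integrable_comp_mul_smul_mul h.2.1 hφ.contDiff.continuous hφ.hasCompactSupport
    hφ.tsupport_subset
  calc ∫ p, F p * (φ p - φ (mul p (-w)))
      = ∫ p, ∫ τ in Set.Icc (0 : ℝ) 1,
          F p * fderiv ℝ φ (mul p (τ • -w)) (lvf w (mul p (τ • -w))) := by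
        simp only [integral_const_mul,
          ← sub_comp_mul_neg_eq_integral (hφ.contDiff.of_le (m := 1) (by simp))]
    _ = ∫ τ in Set.Icc (0 : ℝ) 1, ∫ p,
          F p * fderiv ℝ φ (mul p (τ • -w)) (lvf w (mul p (τ • -w))) :=
        (integral_integral_swap hintF).symm
    _ = ∫ τ in Set.Icc (0 : ℝ) 1, -∫ p, G (mul p (τ • w)) * φ p :=
        setIntegral_congr_fun measurableSet_Icc fun _ hτ => h.integral_comp_mul_smul hφ hτ
    _ = -∫ p, flowAverage w G p * φ p := by
        rw [integral_neg, integral_integral_swap hintG]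
        simp only [integral_mul_const, flowAverage]

theorem ae_mul_sub_eq_flowAverage (hΩ : IsOpen Ω) (h : HasWeakDeriv Ω (lvf w) F G) :
    ∀ᵐ p ∂volume.restrict (flowCore Ω w), F (mul p w) - F p = flowAverage w G p := by
  have hcore : IsOpen (flowCore Ω w) := isOpen_flowCore hΩ
  have hdiff : LocallyIntegrableOn (fun p => F (mul p w) - F p) (flowCore Ω w) :=
    ((locallyIntegrableOn_comp_mulRight hΩ h.1 w).mono_set flowCore_subset_preimage_mulRight).sub
      (h.1.mono_set flowCore_subset)
  have havg := locallyIntegrableOn_flowAverage (w := w) hΩ h.2.1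
  have hzero := hcore.ae_eq_zero_of_integral_contDiff_smul_eq_zero (hdiff.sub havg)
    fun φ hφ hc hsub => ?_
  · filter_upwards [(ae_restrict_iff' hcore.measurableSet).2 hzero] with p hp
    exact sub_eq_zero.1 hp
  · have hφ : IsTestFunction (flowCore Ω w) φ := ⟨hφ, hc, hsub⟩
    simp only [Pi.sub_apply, smul_eq_mul, mul_comm (φ _), sub_mul _ (flowAverage _ _ _)]
    rw [integral_sub (hφ.integrable_mul hdiff) (hφ.integrable_mul havg),
      integral_sub_mul_eq_neg_integral hΩ h.1 hφ, h.integral_mul_sub_comp_eq hφ]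
    ring

end HasWeakDeriv

end FlowAverage

section Taylor

variable {Ω B : Set (Heis n)} {s : ℝ≥0∞} {w : Heis n} {F G H : Heis n → ℝ}

lemma ae_integrable_comp_mul_smul (hΩ : IsOpen Ω) (hG : LocallyIntegrableOn G Ω) :
    ∀ᵐ p ∂volume.restrict (flowCore Ω w),
      Integrable (fun τ : ℝ => G (mul p (τ • w))) (volume.restrict (Set.Icc (0 : ℝ) 1)) := by
  have hcore : IsOpen (flowCore Ω w) := isOpen_flowCore hΩ
  refine (ae_restrict_iff' hcore.measurableSet).2 (measure_null_of_locally_null _ fun p hp => ?_)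
  obtain ⟨K, hK, hpK, hKΩ⟩ := exists_compact_subset hcore (Classical.not_imp.1 hp).1
  have hae := (ae_restrict_iff' hK.measurableSet).1
    (integrable_comp_mul_smul hG hK hKΩ).prod_left_ae
  refine ⟨_, inter_mem_nhdsWithin _ (mem_interior_iff_mem_nhds.1 hpK), measure_mono_null ?_ hae⟩
  exact fun q hq hqK => hq.1 fun _ => hqK hq.2

lemma measurePreserving_mulRight_restrict (hB : MeasurableSet B) (v : Heis n) :
    MeasurePreserving (fun p => mul p v) (volume.restrict (mulRight v ⁻¹' B))
      (volume.restrict B) :=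
  (measurePreserving_mulRight v).restrict_preimage hB

lemma aestronglyMeasurable_comp_mul {S : Set (Heis n)} {v : Heis n} (hB : MeasurableSet B)
    (hSB : S ⊆ mulRight v ⁻¹' B) (hG : AEStronglyMeasurable G (volume.restrict B)) :
    AEStronglyMeasurable (fun p => G (mul p v)) (volume.restrict S) :=
  (hG.comp_measurePreserving (measurePreserving_mulRight_restrict hB v)).mono_measure
    (Measure.restrict_mono hSB le_rfl)

lemma eLpNorm_comp_mul_le {S : Set (Heis n)} {v : Heis n} (hB : MeasurableSet B)
    (hSB : S ⊆ mulRight v ⁻¹' B) (hG : AEStronglyMeasurable G (volume.restrict B)) :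
    eLpNorm (fun p => G (mul p v)) s (volume.restrict S) ≤ eLpNorm G s (volume.restrict B) :=
  (eLpNorm_mono_measure _ (Measure.restrict_mono hSB le_rfl)).trans_eq
    (eLpNorm_comp_measurePreserving hG (measurePreserving_mulRight_restrict hB v))

lemma flowCore_subset_flowCore_smul {τ : ℝ} (hτ : τ ∈ Set.Icc (0 : ℝ) 1) :
    flowCore Ω w ⊆ flowCore Ω (τ • w) := fun p hp σ hσ => by
  rw [smul_smul]
  exact hp _ ⟨mul_nonneg hσ.1 hτ.1, mul_le_one₀ hσ.2 hτ.1 hτ.2⟩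

/-- The `L^s` modulus of continuity of `F 1_Ω` along the flow of `lvf v` for the times in
`[0, 1]`. -/
def translationModulus (Ω : Set (Heis n)) (s : ℝ≥0∞) (F : Heis n → ℝ) (v : Heis n) : ℝ≥0∞ :=
  ⨆ τ ∈ Set.Icc (0 : ℝ) 1, eLpNorm (fun p => Ω.indicator F (mul p (τ • v)) - Ω.indicator F p) s

lemma translationModulus_const_mul (c : ℝ) (F : Heis n → ℝ) (v : Heis n) :
    translationModulus Ω s (fun p => c * F p) v = ‖c‖ₑ * translationModulus Ω s F v := by
  simp only [translationModulus, Set.indicator_const_mul, ← mul_sub, eLpNorm_const_mul,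
    ENNReal.mul_iSup]

lemma translationModulus_smul_le {τ : ℝ} (hτ : τ ∈ Set.Icc (0 : ℝ) 1) :
    translationModulus Ω s F (τ • w) ≤ translationModulus Ω s F w := by
  refine iSup₂_le fun σ hσ => ?_
  rw [smul_smul]
  exact le_iSup₂_of_le (σ * τ) ⟨mul_nonneg hσ.1 hτ.1, mul_le_one₀ hσ.2 hτ.1 hτ.2⟩ le_rfl

lemma eLpNorm_mul_smul_sub_le_translationModulus (hΩ : IsOpen Ω) {τ : ℝ}
    (hτ : τ ∈ Set.Icc (0 : ℝ) 1) :
    eLpNorm (fun p => F (mul p (τ • w)) - F p) s (volume.restrict (flowCore Ω w)) ≤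
      translationModulus Ω s F w := by
  have heq : (fun p => F (mul p (τ • w)) - F p) =ᵐ[volume.restrict (flowCore Ω w)]
      fun p => Ω.indicator F (mul p (τ • w)) - Ω.indicator F p :=
    (ae_restrict_iff' (isOpen_flowCore hΩ).measurableSet).2 <| ae_of_all _ fun p hp => by
      simp only [Set.indicator_of_mem (hp τ hτ), Set.indicator_of_mem (flowCore_subset hp)]
  rw [eLpNorm_congr_ae heq]
  exact (eLpNorm_mono_measure _ Measure.restrict_le_self).trans (le_iSup₂_of_le τ hτ le_rfl)

lemma tendsto_translationModulus (hs1 : 1 ≤ s) (hs : s ≠ ⊤) (hΩ : MeasurableSet Ω)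
    (hF : MemLp F s (volume.restrict Ω)) :
    Tendsto (translationModulus Ω s F) (𝓝 0) (𝓝 0) := by
  refine ENNReal.tendsto_nhds_zero.2 fun η hη => ?_
  have htrans := tendsto_eLpNorm_mul_sub hs1 hs ((memLp_indicator_iff_restrict hΩ).2 hF)
  obtain ⟨r, hr, hball⟩ :=
    Metric.eventually_nhds_iff_ball.1 (ENNReal.tendsto_nhds_zero.1 htrans η hη)
  filter_upwards [Metric.ball_mem_nhds 0 hr] with v hv
  refine iSup₂_le fun τ hτ => hball _ ?_
  rw [mem_ball_zero_iff] at hv ⊢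
  rw [norm_smul, Real.norm_of_nonneg hτ.1]
  exact (mul_le_of_le_one_left (norm_nonneg v) hτ.2).trans_lt hv

instance : IsProbabilityMeasure (volume.restrict (Set.Icc (0 : ℝ) 1)) := ⟨by simp⟩

namespace HasWeakDeriv

lemma lvf_smul (h : HasWeakDeriv Ω (lvf w) F G) (c : ℝ) :
    HasWeakDeriv Ω (lvf (c • w)) F fun p => c * G p := by
  rw [show lvf (c • w) = fun p => c • lvf w p from funext (Heis.lvf_smul c w)]
  exact h.smul_field c

lemma eLpNorm_remainder_le (hs1 : 1 ≤ s) (hΩ : IsOpen Ω) (h : HasWeakDeriv Ω (lvf w) F G)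
    {P Q : Heis n → ℝ} (hP : AEStronglyMeasurable P (volume.restrict (flowCore Ω w)))
    (hQ : AEStronglyMeasurable Q (volume.restrict (flowCore Ω w))) {C : ℝ≥0∞}
    (hC : ∀ τ ∈ Set.Icc (0 : ℝ) 1, eLpNorm (fun p => G (mul p (τ • w)) - P p - τ * Q p) s
      (volume.restrict (flowCore Ω w)) ≤ C) :
    eLpNorm (fun p => F (mul p w) - F p - P p - 1 / 2 * Q p) s
      (volume.restrict (flowCore Ω w)) ≤ C := by
  have hmeas : AEStronglyMeasurable
      (Function.uncurry fun (τ : ℝ) p => G (mul p (τ • w)) - P p - τ * Q p)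
      ((volume.restrict (Set.Icc (0 : ℝ) 1)).prod (volume.restrict (flowCore Ω w))) :=
    ((aestronglyMeasurable_comp_mul_smul hΩ.measurableSet h.2.1.aestronglyMeasurable).sub
      hP.comp_snd).sub (continuous_fst.aestronglyMeasurable.mul hQ.comp_snd)
  refine (eLpNorm_congr_ae ?_).trans_le
    (eLpNorm_integral_le hs1 hmeas ((ae_restrict_iff' measurableSet_Icc).2 (ae_of_all _ hC)))
  filter_upwards [h.ae_mul_sub_eq_flowAverage hΩ, ae_integrable_comp_mul_smul hΩ h.2.1]
    with p hFTC hint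
  have hlin : Integrable (fun τ : ℝ => τ * Q p) (volume.restrict (Set.Icc (0 : ℝ) 1)) :=
    Continuous.integrableOn_Icc (by fun_prop)
  have hhalf : ∫ τ in Set.Icc (0 : ℝ) 1, τ * Q p = 1 / 2 * Q p := by
    rw [integral_mul_const, integral_Icc_eq_integral_Ioc,
      ← intervalIntegral.integral_of_le zero_le_one, integral_id]
    norm_num
  rw [integral_sub (by exact hint.sub (integrable_const _)) hlin,
    integral_sub hint (integrable_const _), hhalf, hFTC, flowAverage]
  simp

lemma eLpNorm_mul_sub_le (hs1 : 1 ≤ s) (hΩ : IsOpen Ω) (h : HasWeakDeriv Ω (lvf w) F G) :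
    eLpNorm (fun p => F (mul p w) - F p) s (volume.restrict (flowCore Ω w)) ≤
      eLpNorm G s (volume.restrict Ω) := by
  simpa using h.eLpNorm_remainder_le hs1 hΩ (P := 0) (Q := 0) aestronglyMeasurable_zero
    aestronglyMeasurable_zero fun τ hτ => by
      simpa using eLpNorm_comp_mul_le hΩ.measurableSet (flowCore_subset_preimage_mulRight_smul hτ)
        h.2.1.aestronglyMeasurable

lemma eLpNorm_mul_sub_sub_le (hs1 : 1 ≤ s) (hΩ : IsOpen Ω) (h : HasWeakDeriv Ω (lvf w) F G)
    {C : ℝ≥0∞} (hC : ∀ τ ∈ Set.Icc (0 : ℝ) 1, eLpNorm (fun p => G (mul p (τ • w)) - G p) s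
      (volume.restrict (flowCore Ω w)) ≤ C) :
    eLpNorm (fun p => F (mul p w) - F p - G p) s (volume.restrict (flowCore Ω w)) ≤ C := by
  simpa using h.eLpNorm_remainder_le hs1 hΩ (Q := 0)
    (h.2.1.mono_set flowCore_subset).aestronglyMeasurable aestronglyMeasurable_zero
    fun τ hτ => by simpa using hC τ hτ

lemma eLpNorm_mul_sub_sub_le_translationModulus (hs1 : 1 ≤ s) (hΩ : IsOpen Ω)
    (h : HasWeakDeriv Ω (lvf w) F G) :
    eLpNorm (fun p => F (mul p w) - F p - G p) s (volume.restrict (flowCore Ω w)) ≤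
      translationModulus Ω s G w :=
  h.eLpNorm_mul_sub_sub_le hs1 hΩ fun _ hτ => eLpNorm_mul_smul_sub_le_translationModulus hΩ hτ

lemma eLpNorm_taylor_one_le (hs1 : 1 ≤ s) (hΩ : IsOpen Ω) (hFG : HasWeakDeriv Ω (lvf w) F G)
    (hGH : HasWeakDeriv Ω (lvf w) G H) :
    eLpNorm (fun p => F (mul p w) - F p - G p) s (volume.restrict (flowCore Ω w)) ≤
      eLpNorm H s (volume.restrict Ω) := by
  refine hFG.eLpNorm_mul_sub_sub_le hs1 hΩ fun τ hτ => ?_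
  calc eLpNorm (fun p => G (mul p (τ • w)) - G p) s (volume.restrict (flowCore Ω w))
      ≤ eLpNorm (fun p => G (mul p (τ • w)) - G p) s (volume.restrict (flowCore Ω (τ • w))) :=
        eLpNorm_mono_measure _ (Measure.restrict_mono (flowCore_subset_flowCore_smul hτ) le_rfl)
    _ ≤ eLpNorm (fun p => τ * H p) s (volume.restrict Ω) :=
        (hGH.lvf_smul τ).eLpNorm_mul_sub_le hs1 hΩ
    _ ≤ eLpNorm H s (volume.restrict Ω) := by
        rw [eLpNorm_const_mul]
        exact mul_le_of_le_one_left' (enorm_le_one_of_mem_Icc hτ)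

lemma eLpNorm_taylor_two_le_translationModulus (hs1 : 1 ≤ s) (hΩ : IsOpen Ω)
    (hFG : HasWeakDeriv Ω (lvf w) F G) (hGH : HasWeakDeriv Ω (lvf w) G H) :
    eLpNorm (fun p => F (mul p w) - F p - G p - 1 / 2 * H p) s
      (volume.restrict (flowCore Ω w)) ≤ translationModulus Ω s H w := by
  refine hFG.eLpNorm_remainder_le hs1 hΩ (hFG.2.1.mono_set flowCore_subset).aestronglyMeasurable
    (hGH.2.1.mono_set flowCore_subset).aestronglyMeasurable fun τ hτ => ?_
  calc eLpNorm (fun p => G (mul p (τ • w)) - G p - τ * H p) s (volume.restrict (flowCore Ω w))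
      ≤ eLpNorm (fun p => G (mul p (τ • w)) - G p - τ * H p) s
          (volume.restrict (flowCore Ω (τ • w))) :=
        eLpNorm_mono_measure _ (Measure.restrict_mono (flowCore_subset_flowCore_smul hτ) le_rfl)
    _ ≤ translationModulus Ω s (fun p => τ * H p) (τ • w) :=
        (hGH.lvf_smul τ).eLpNorm_mul_sub_sub_le_translationModulus hs1 hΩ
    _ ≤ translationModulus Ω s H w := by
        rw [translationModulus_const_mul]
        exact (mul_le_of_le_one_left' (enorm_le_one_of_mem_Icc hτ)).trans
          (translationModulus_smul_le hτ)

end HasWeakDeriv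

end Taylor

section TwoStep

variable {Ω A : Set (Heis n)} {s : ℝ≥0∞} {u : Horizontal n} {t : ℝ}
  {F G H P Q W : Heis n → ℝ}

/-- The points `p` from which the horizontal path `p · (τ u, 0)` followed by the vertical path
`p · (u, 0) · (0, τ t)`, for `τ ∈ [0, 1]`, stays in `Ω`. -/
def twoStepCore (Ω : Set (Heis n)) (u : Horizontal n) (t : ℝ) : Set (Heis n) :=
  flowCore Ω (u, 0) ∩ mulRight (u, 0) ⁻¹' flowCore Ω (0, t)

lemma subset_twoStepCore (hn : 1 ≤ n) (hΩ : IsOpen Ω) (hAΩ : A ⊆ Ω)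
    (hut : ENNReal.ofReal (‖u‖ + 2 * √|t|) < ccSetDist A (frontier Ω)) :
    A ⊆ twoStepCore Ω u t := by
  intro p hp
  have hnear : ∀ r ∈ Set.Icc (0 : ℝ) 1, ∀ r' ∈ Set.Icc (0 : ℝ) 1,
      ccDist p (mul (mul p (r • (u, 0))) (r' • (0, t))) < ccSetDist A (frontier Ω) := by
    intro r hr r' hr'
    simp only [Prod.smul_mk, smul_zero, smul_eq_mul, MulZeroClass.mul_zero]
    refine ((ccDist_mul_mul_le hn p (r • u) (r' * t)).trans (ENNReal.ofReal_le_ofReal ?_)).trans_lt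
      hut
    rw [norm_smul, abs_mul, Real.norm_of_nonneg hr.1, abs_of_nonneg hr'.1]
    gcongr
    · exact mul_le_of_le_one_left (norm_nonneg u) hr.2
    · exact mul_le_of_le_one_left (abs_nonneg t) hr'.2
  have hhorizontal : p ∈ flowCore Ω (u, 0) := fun τ hτ =>
    mem_of_ccDist_lt hΩ hp (c := fun r => mul p (r • (u, 0))) (by fun_prop)
      (by simpa using hAΩ hp) (fun r hr => by simpa using hnear r hr 0 (by simp)) τ hτ
  refine ⟨hhorizontal, fun τ hτ => ?_⟩
  exact mem_of_ccDist_lt hΩ hp (c := fun r => mul (mul p (u, 0)) (r • (0, t))) (by fun_prop)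
    (by simpa using flowCore_subset_preimage_mulRight hhorizontal)
    (fun r hr => by simpa using hnear 1 (by simp) r hr) τ hτ

lemma mul_mul_horizontal_vertical (p : Heis n) (u : Horizontal n) (t : ℝ) :
    mul (mul p (u, 0)) (0, t) = mul p (u, t) := by
  rw [Heis.mul_assoc, mul_horizontal_vertical]

lemma twoStepCore_subset_preimage_mulRight :
    twoStepCore Ω u t ⊆ mulRight (u, t) ⁻¹' Ω := fun p hp => by
  simpa only [Set.mem_preimage, mulRight_apply, mul_mul_horizontal_vertical]
    using flowCore_subset_preimage_mulRight hp.2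

lemma twoStepCore_subset : twoStepCore Ω u t ⊆ Ω := Set.inter_subset_left.trans flowCore_subset

lemma aestronglyMeasurable_mul_sub_sub (hΩ : IsOpen Ω) {w : Heis n}
    (hF : AEStronglyMeasurable F (volume.restrict Ω))
    (hP : AEStronglyMeasurable P (volume.restrict Ω)) :
    AEStronglyMeasurable (fun p => F (mul p w) - F p - P p) (volume.restrict (flowCore Ω w)) :=
  ((aestronglyMeasurable_comp_mul hΩ.measurableSet flowCore_subset_preimage_mulRight hF).sub
    (hF.mono_set flowCore_subset)).sub (hP.mono_set flowCore_subset)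

lemma eLpNorm_two_step_le (hs1 : 1 ≤ s) (hΩ : IsOpen Ω) {C D : ℝ≥0∞}
    (hF : AEStronglyMeasurable F (volume.restrict Ω))
    (hP : AEStronglyMeasurable P (volume.restrict Ω))
    (hQ : AEStronglyMeasurable Q (volume.restrict Ω))
    (hvertical : eLpNorm (fun p => F (mul p (0, t)) - F p - Q p) s
      (volume.restrict (flowCore Ω (0, t))) ≤ C)
    (hhorizontal : eLpNorm (fun p => F (mul p (u, 0)) - F p - P p) s
      (volume.restrict (flowCore Ω (u, 0))) ≤ D) :
    eLpNorm (fun p => F (mul p (u, t)) - F p - P p - Q (mul p (u, 0))) s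
      (volume.restrict (twoStepCore Ω u t)) ≤ C + D := by
  have hcore : MeasurableSet (flowCore Ω ((0, t) : Heis n)) := (isOpen_flowCore hΩ).measurableSet
  have hmeasV := aestronglyMeasurable_mul_sub_sub (w := (0, t)) hΩ hF hQ
  have hmeasH := aestronglyMeasurable_mul_sub_sub (w := (u, 0)) hΩ hF hP
  have hsplit : (fun p => F (mul p (u, t)) - F p - P p - Q (mul p (u, 0))) =
      (fun p => F (mul (mul p (u, 0)) (0, t)) - F (mul p (u, 0)) - Q (mul p (u, 0))) +
        fun p => F (mul p (u, 0)) - F p - P p := by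
    funext p
    simp only [Pi.add_apply, mul_mul_horizontal_vertical]
    ring
  rw [hsplit]
  refine (eLpNorm_add_le (aestronglyMeasurable_comp_mul hcore Set.inter_subset_right hmeasV)
    (hmeasH.mono_set Set.inter_subset_left) hs1).trans (add_le_add ?_ ?_)
  · exact (eLpNorm_comp_mul_le hcore Set.inter_subset_right hmeasV).trans hvertical
  · exact (eLpNorm_mono_measure _ (Measure.restrict_mono Set.inter_subset_left le_rfl)).trans
      hhorizontal

lemma HasWeakDeriv.vertical (h : HasWeakDeriv Ω T F W) (t : ℝ) :
    HasWeakDeriv Ω (lvf (0, t)) F fun p => t * W p := by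
  rw [T_eq_lvf] at h
  simpa using h.lvf_smul t

theorem eLpNorm_increment_le (hs1 : 1 ≤ s) (hΩ : IsOpen Ω) (hFG : HasWeakDeriv Ω (lvf (u, 0)) F G)
    (hGH : HasWeakDeriv Ω (lvf (u, 0)) G H) (hFW : HasWeakDeriv Ω T F W) :
    eLpNorm (fun p => F (mul p (u, t)) - F p - G p) s (volume.restrict (twoStepCore Ω u t)) ≤
      ‖t‖ₑ * eLpNorm W s (volume.restrict Ω) + eLpNorm H s (volume.restrict Ω) := by
  have hvertical := (hFW.vertical t).eLpNorm_mul_sub_le hs1 hΩ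
  rw [eLpNorm_const_mul] at hvertical
  simpa using eLpNorm_two_step_le (Q := 0) hs1 hΩ hFG.1.aestronglyMeasurable
    hFG.2.1.aestronglyMeasurable aestronglyMeasurable_zero (by simpa using hvertical)
    (hFG.eLpNorm_taylor_one_le hs1 hΩ hGH)

theorem eLpNorm_increment_sub_le (hs1 : 1 ≤ s) (hΩ : IsOpen Ω)
    (hFG : HasWeakDeriv Ω (lvf (u, 0)) F G) (hGH : HasWeakDeriv Ω (lvf (u, 0)) G H)
    (hFW : HasWeakDeriv Ω T F W) :
    eLpNorm (fun p => F (mul p (u, t)) - F p - G p - (1 / 2 * H p + t * W p)) s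
      (volume.restrict (twoStepCore Ω u t)) ≤
      ‖t‖ₑ * (translationModulus Ω s W (0, t) + translationModulus Ω s W (u, 0)) +
        translationModulus Ω s H (u, 0) := by
  have hmeasF := hFG.1.aestronglyMeasurable
  have hmeasP := hFG.2.1.aestronglyMeasurable.add
    (hGH.2.1.aestronglyMeasurable.const_mul (1 / 2))
  have hmeasW := hFW.2.1.aestronglyMeasurable
  have hvertical := (hFW.vertical t).eLpNorm_mul_sub_sub_le_translationModulus hs1 hΩ
  rw [translationModulus_const_mul] at hvertical
  have hhorizontal := hFG.eLpNorm_taylor_two_le_translationModulus hs1 hΩ hGH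
  simp only [sub_sub _ (G _)] at hhorizontal
  have htwo := eLpNorm_two_step_le hs1 hΩ hmeasF hmeasP (hmeasW.const_mul t) hvertical hhorizontal
  have hshift : eLpNorm (fun p => t * (W (mul p (u, 0)) - W p)) s
      (volume.restrict (twoStepCore Ω u t)) ≤ ‖t‖ₑ * translationModulus Ω s W (u, 0) := by
    rw [eLpNorm_const_mul]
    gcongr
    refine (eLpNorm_mono_measure _ (Measure.restrict_mono Set.inter_subset_left le_rfl)).trans ?_
    simpa using eLpNorm_mul_smul_sub_le_translationModulus hΩ (τ := 1) (by simp)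
  have hmeasW' := aestronglyMeasurable_comp_mul hΩ.measurableSet
    (Set.inter_subset_left.trans flowCore_subset_preimage_mulRight : twoStepCore Ω u t ⊆ _) hmeasW
  have hmeas := (((aestronglyMeasurable_comp_mul hΩ.measurableSet
    twoStepCore_subset_preimage_mulRight hmeasF).sub (hmeasF.mono_set twoStepCore_subset)).sub
      (hmeasP.mono_set twoStepCore_subset)).sub (hmeasW'.const_mul t)
  have hsplit : (fun p => F (mul p (u, t)) - F p - G p - (1 / 2 * H p + t * W p)) =
      (fun p => F (mul p (u, t)) - F p - (G p + 1 / 2 * H p) - t * W (mul p (u, 0))) +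
        fun p => t * (W (mul p (u, 0)) - W p) := by
    funext p
    simp only [Pi.add_apply]
    ring
  rw [hsplit, mul_add, add_right_comm]
  exact (eLpNorm_add_le hmeas ((hmeasW'.sub (hmeasW.mono_set twoStepCore_subset)).const_mul t)
    hs1).trans (add_le_add htwo hshift)

end TwoStep

section Sobolev

variable {k : ℕ} {Ω A : Set (Heis n)} {s : ℝ≥0∞} {f g : Heis n → ℝ} {w : Heis n} {ε : ℝ}

namespace MemSobolev

lemma memLp (hf : MemSobolev Ω s k f) : MemLp f s (volume.restrict Ω) := by
  cases k with
  | zero => exact hf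
  | succ k => exact hf.1

lemma hasWeakDeriv (hf : MemSobolev Ω s (k + 1) f) (i : Fin n ⊕ Fin n) :
    HasWeakDeriv Ω (Z i) f (weakDeriv Ω (Z i) f) :=
  (hf.2 i).choose_spec.1.weakDeriv

lemma congr_ae (hf : MemSobolev Ω s k f) (h : f =ᵐ[volume.restrict Ω] g) :
    MemSobolev Ω s k g := by
  cases k with
  | zero => exact (memLp_congr_ae h).1 hf
  | succ k =>
    refine ⟨(memLp_congr_ae h).1 hf.1, fun i => ?_⟩
    obtain ⟨g', hg', hmem⟩ := hf.2 i
    exact ⟨g', hg'.congr_ae h (ae_eq_refl _), hmem⟩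

lemma weakDeriv (hΩ : IsOpen Ω) (hf : MemSobolev Ω s (k + 1) f) (i : Fin n ⊕ Fin n) :
    MemSobolev Ω s k (weakDeriv Ω (Z i) f) := by
  obtain ⟨g, hg, hmem⟩ := hf.2 i
  exact hmem.congr_ae (hg.ae_eq hΩ hg.weakDeriv)

end MemSobolev

lemma inner_hGrad (f : Heis n → ℝ) (u : Horizontal n) (p : Heis n) :
    inner ℝ (hGrad Ω f p) u = ∑ i, u i * weakDeriv Ω (Z i) f p := by
  simp [hGrad, PiLp.inner_apply]

lemma inner_hHess (f : Heis n → ℝ) (u : Horizontal n) (p : Heis n) :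
    inner ℝ (hHess Ω f p u) u =
      ∑ j, u j * ∑ i, u i * weakDeriv Ω (Z i) (weakDeriv Ω (Z j) f) p := by
  have hcoord : ∀ i, hHess Ω f p u i =
      ∑ j, weakDeriv Ω (Z i) (weakDeriv Ω (Z j) f) p * u j := fun i => by
    simp [hHess, Matrix.ofLp_toEuclideanCLM, Matrix.mulVec, dotProduct]
  simp only [PiLp.inner_apply, hcoord, RCLike.inner_apply, conj_trivial, Finset.mul_sum]
  rw [Finset.sum_comm]
  exact Finset.sum_congr rfl fun _ _ => Finset.sum_congr rfl fun _ _ => by ring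

lemma inner_hHess_smul (f : Heis n → ℝ) (ε : ℝ) (u : Horizontal n) (p : Heis n) :
    inner ℝ (hHess Ω f p (ε • u)) (ε • u) = ε ^ 2 * inner ℝ (hHess Ω f p u) u := by
  rw [map_smul, real_inner_smul_left, real_inner_smul_right]
  ring

lemma eLpNorm_inner_hHess_le (f : Heis n → ℝ) (u : Horizontal n) (μ : Measure (Heis n)) :
    eLpNorm (fun p => inner ℝ (hHess Ω f p u) u) s μ ≤
      ENNReal.ofReal (‖u‖ ^ 2) * eLpNorm (fun p => ‖hHess Ω f p‖) s μ := by
  rw [← Real.enorm_of_nonneg (sq_nonneg ‖u‖), ← eLpNorm_const_mul]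
  refine eLpNorm_mono fun p => ?_
  rw [norm_mul, norm_norm, norm_pow, norm_norm]
  calc ‖inner ℝ (hHess Ω f p u) u‖ ≤ ‖hHess Ω f p u‖ * ‖u‖ := norm_inner_le_norm _ _
    _ ≤ ‖hHess Ω f p‖ * ‖u‖ * ‖u‖ := by gcongr; exact ContinuousLinearMap.le_opNorm _ _
    _ = ‖u‖ ^ 2 * ‖hHess Ω f p‖ := by ring

namespace MemSobolev

lemma memLp_inner_hGrad (hΩ : IsOpen Ω) (hf : MemSobolev Ω s (k + 1) f) (u : Horizontal n) :
    MemLp (fun p => inner ℝ (hGrad Ω f p) u) s (volume.restrict Ω) := by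
  simp only [inner_hGrad]
  exact memLp_finsetSum _ fun i _ => (hf.weakDeriv hΩ i).memLp.const_mul (u i)

lemma memLp_inner_hHess (hΩ : IsOpen Ω) (hf : MemSobolev Ω s (k + 2) f) (u : Horizontal n) :
    MemLp (fun p => inner ℝ (hHess Ω f p u) u) s (volume.restrict Ω) := by
  simp only [inner_hHess]
  exact memLp_finsetSum _ fun j _ => (memLp_finsetSum _ fun i _ =>
    ((hf.weakDeriv hΩ j).weakDeriv hΩ i).memLp.const_mul (u i)).const_mul (u j)

lemma hasWeakDeriv_inner_hGrad (hs1 : 1 ≤ s) (hf : MemSobolev Ω s (k + 1) f) (u : Horizontal n) :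
    HasWeakDeriv Ω (lvf (u, 0)) f fun p => inner ℝ (hGrad Ω f p) u := by
  simp only [inner_hGrad]
  exact hasWeakDeriv_lvf_horizontal (locallyIntegrableOn_of_locallyIntegrable_restrict
    (hf.memLp.locallyIntegrable hs1)) hf.hasWeakDeriv u

lemma hasWeakDeriv_inner_hHess (hΩ : IsOpen Ω) (hf : MemSobolev Ω s (k + 2) f)
    (u : Horizontal n) :
    HasWeakDeriv Ω (lvf (u, 0)) (fun p => inner ℝ (hGrad Ω f p) u)
      fun p => inner ℝ (hHess Ω f p u) u := by
  simp only [inner_hGrad, inner_hHess]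
  exact .sum (continuous_lvf _) fun j => (hasWeakDeriv_lvf_horizontal (hf.hasWeakDeriv j).2.1
    (fun i => (hf.weakDeriv hΩ j).hasWeakDeriv i) u).smul (u j)

lemma exists_hasWeakDeriv_T (hn : 1 ≤ n) (hΩ : IsOpen Ω) (hf : MemSobolev Ω s (k + 2) f) :
    ∃ g, HasWeakDeriv Ω T f g ∧ MemLp g s (volume.restrict Ω) := by
  have hsecond : ∀ i j, MemLp (Heis.weakDeriv Ω (Z i) (Heis.weakDeriv Ω (Z j) f)) s
      (volume.restrict Ω) := fun i j => ((hf.weakDeriv hΩ j).weakDeriv hΩ i).memLp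
  exact ⟨_, hasWeakDeriv_T ⟨0, hn⟩ (hf.hasWeakDeriv _) (hf.hasWeakDeriv _)
    ((hf.weakDeriv hΩ _).hasWeakDeriv _) ((hf.weakDeriv hΩ _).hasWeakDeriv _),
    ((hsecond _ _).sub (hsecond _ _)).const_mul _⟩

lemma hasWeakDeriv_T (hn : 1 ≤ n) (hΩ : IsOpen Ω) (hf : MemSobolev Ω s (k + 2) f) :
    HasWeakDeriv Ω T f (Heis.weakDeriv Ω T f) :=
  (hf.exists_hasWeakDeriv_T hn hΩ).choose_spec.1.weakDeriv

lemma memLp_weakDeriv_T (hn : 1 ≤ n) (hΩ : IsOpen Ω) (hf : MemSobolev Ω s (k + 2) f) :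
    MemLp (Heis.weakDeriv Ω T f) s (volume.restrict Ω) := by
  obtain ⟨g, hg, hmem⟩ := hf.exists_hasWeakDeriv_T hn hΩ
  exact (memLp_congr_ae (hg.ae_eq hΩ hg.weakDeriv)).1 hmem

lemma memLp_taylor_two (hn : 1 ≤ n) (hΩ : IsOpen Ω) (hf : MemSobolev Ω s (k + 2) f) (w : Heis n) :
    MemLp (fun p => 1 / 2 * inner ℝ (hHess Ω f p w.1) w.1 + w.2 * Heis.weakDeriv Ω T f p) s
      (volume.restrict Ω) :=
  ((hf.memLp_inner_hHess hΩ w.1).const_mul (1 / 2)).add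
    ((hf.memLp_weakDeriv_T hn hΩ).const_mul w.2)

end MemSobolev

lemma diffQuot₂_eq (f : Heis n → ℝ) (w : Heis n) (ε : ℝ) (p : Heis n) :
    diffQuot₂ Ω f w ε p = (ε ^ 2)⁻¹ * (f (mul p (ε • w.1, ε ^ 2 * w.2)) - f p -
      inner ℝ (hGrad Ω f p) (ε • w.1)) := by
  rw [diffQuot₂, dil, div_eq_inv_mul, real_inner_smul_right]

lemma subset_twoStepCore_dil (hn : 1 ≤ n) (hΩ : IsOpen Ω) (hAΩ : A ⊆ Ω) (hε : 0 < ε)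
    (hεw : ENNReal.ofReal (ε * (‖w.1‖ + 2 * √|w.2|)) < ccSetDist A (frontier Ω)) :
    A ⊆ twoStepCore Ω (ε • w.1) (ε ^ 2 * w.2) := by
  refine subset_twoStepCore hn hΩ hAΩ ?_
  convert hεw using 2
  rw [norm_smul, Real.norm_of_nonneg hε.le, abs_mul, abs_sq, Real.sqrt_mul (sq_nonneg ε),
    Real.sqrt_sq hε.le]
  ring

namespace MemSobolev

lemma memLp_diffQuot₂ (hΩ : IsOpen Ω) (hf : MemSobolev Ω s (k + 1) f) :
    MemLp (diffQuot₂ Ω f w ε) s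
      (volume.restrict (twoStepCore Ω (ε • w.1) (ε ^ 2 * w.2))) := by
  simp only [funext (diffQuot₂_eq f w ε)]
  have hcore := Measure.restrict_mono
    (twoStepCore_subset (Ω := Ω) (u := ε • w.1) (t := ε ^ 2 * w.2)) le_rfl (μ := volume)
  have htranslate := (hf.memLp.comp_measurePreserving
    (measurePreserving_mulRight_restrict hΩ.measurableSet (ε • w.1, ε ^ 2 * w.2))).mono_measure
      (Measure.restrict_mono twoStepCore_subset_preimage_mulRight le_rfl)
  exact ((htranslate.sub (hf.memLp.mono_measure hcore)).sub
    ((hf.memLp_inner_hGrad hΩ _).mono_measure hcore)).const_mul _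

theorem eLpNorm_diffQuot₂_le (hn : 1 ≤ n) (hs1 : 1 ≤ s) (hΩ : IsOpen Ω)
    (hf : MemSobolev Ω s (k + 2) f) (hε : ε ≠ 0) :
    eLpNorm (diffQuot₂ Ω f w ε) s (volume.restrict (twoStepCore Ω (ε • w.1) (ε ^ 2 * w.2))) ≤
      ‖w.2‖ₑ * eLpNorm (Heis.weakDeriv Ω T f) s (volume.restrict Ω) +
        eLpNorm (fun p => inner ℝ (hHess Ω f p w.1) w.1) s (volume.restrict Ω) := by
  simp only [funext (diffQuot₂_eq f w ε)]
  refine eLpNorm_inv_mul_le (pow_ne_zero 2 hε) ((eLpNorm_increment_le hs1 hΩ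
    (hf.hasWeakDeriv_inner_hGrad hs1 _) (hf.hasWeakDeriv_inner_hHess hΩ _)
    (hf.hasWeakDeriv_T hn hΩ)).trans_eq ?_)
  simp only [inner_hHess_smul, eLpNorm_const_mul, enorm_mul_mul, mul_add]

theorem eLpNorm_diffQuot₂_sub_le (hn : 1 ≤ n) (hs1 : 1 ≤ s) (hΩ : IsOpen Ω)
    (hf : MemSobolev Ω s (k + 2) f) (hε : ε ≠ 0) :
    eLpNorm (fun p => diffQuot₂ Ω f w ε p -
        (1 / 2 * inner ℝ (hHess Ω f p w.1) w.1 + w.2 * Heis.weakDeriv Ω T f p)) s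
      (volume.restrict (twoStepCore Ω (ε • w.1) (ε ^ 2 * w.2))) ≤
      ‖w.2‖ₑ * (translationModulus Ω s (Heis.weakDeriv Ω T f) (0, ε ^ 2 * w.2) +
          translationModulus Ω s (Heis.weakDeriv Ω T f) (ε • w.1, 0)) +
        translationModulus Ω s (fun p => inner ℝ (hHess Ω f p w.1) w.1) (ε • w.1, 0) := by
  have herror : ∀ p, diffQuot₂ Ω f w ε p -
      (1 / 2 * inner ℝ (hHess Ω f p w.1) w.1 + w.2 * Heis.weakDeriv Ω T f p) =
      (ε ^ 2)⁻¹ * (f (mul p (ε • w.1, ε ^ 2 * w.2)) - f p - inner ℝ (hGrad Ω f p) (ε • w.1) -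
        (1 / 2 * inner ℝ (hHess Ω f p (ε • w.1)) (ε • w.1) +
          ε ^ 2 * w.2 * Heis.weakDeriv Ω T f p)) := fun p => by
    rw [diffQuot₂_eq, inner_hHess_smul]
    field_simp
  simp only [herror]
  refine eLpNorm_inv_mul_le (pow_ne_zero 2 hε) ((eLpNorm_increment_sub_le hs1 hΩ
    (hf.hasWeakDeriv_inner_hGrad hs1 _) (hf.hasWeakDeriv_inner_hHess hΩ _)
    (hf.hasWeakDeriv_T hn hΩ)).trans_eq ?_)
  simp only [inner_hHess_smul, translationModulus_const_mul, enorm_mul_mul, mul_add]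

theorem tendsto_diffQuot₂ (hn : 1 ≤ n) (hs1 : 1 ≤ s) (hs : s ≠ ⊤) (hΩ : IsOpen Ω)
    (hf : MemSobolev Ω s (k + 2) f) (hAΩ : A ⊆ Ω) (hdist : 0 < ccSetDist A (frontier Ω))
    (w : Heis n) :
    Tendsto (fun ε : ℝ => eLpNorm (fun p => diffQuot₂ Ω f w ε p -
        (1 / 2 * inner ℝ (hHess Ω f p w.1) w.1 + w.2 * Heis.weakDeriv Ω T f p)) s
      (volume.restrict A)) (𝓝[>] 0) (𝓝 0) := by
  have hnear : ∀ᶠ ε : ℝ in 𝓝[>] 0,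
      ENNReal.ofReal (ε * (‖w.1‖ + 2 * √|w.2|)) < ccSetDist A (frontier Ω) := by
    have hcont : Continuous fun ε : ℝ => ENNReal.ofReal (ε * (‖w.1‖ + 2 * √|w.2|)) :=
      ENNReal.continuous_ofReal.comp (by fun_prop)
    exact ((hcont.tendsto' 0 0 (by simp)).eventually_lt_const hdist).filter_mono
      nhdsWithin_le_nhds
  have hhor : Tendsto (fun ε : ℝ => ((ε • w.1, 0) : Heis n)) (𝓝[>] 0) (𝓝 0) :=
    (Continuous.tendsto' (by fun_prop) 0 0 (by simp)).mono_left nhdsWithin_le_nhds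
  have hver : Tendsto (fun ε : ℝ => ((0, ε ^ 2 * w.2) : Heis n)) (𝓝[>] 0) (𝓝 0) :=
    (Continuous.tendsto' (by fun_prop) 0 0 (by simp)).mono_left nhdsWithin_le_nhds
  have hT := tendsto_translationModulus hs1 hs hΩ.measurableSet (hf.memLp_weakDeriv_T hn hΩ)
  have hHess := tendsto_translationModulus hs1 hs hΩ.measurableSet
    (hf.memLp_inner_hHess hΩ w.1)
  have hbound := (ENNReal.Tendsto.const_mul ((hT.comp hver).add (hT.comp hhor))
    (Or.inr (enorm_ne_top (x := w.2)))).add (hHess.comp hhor)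
  simp only [add_zero, MulZeroClass.mul_zero] at hbound
  refine tendsto_of_tendsto_of_tendsto_of_le_of_le' tendsto_const_nhds hbound
    (Eventually.of_forall fun _ => zero_le) ?_
  filter_upwards [hnear, self_mem_nhdsWithin] with ε hεw hε
  exact (eLpNorm_mono_measure _ (Measure.restrict_mono
    (subset_twoStepCore_dil hn hΩ hAΩ hε hεw) le_rfl)).trans
      (hf.eLpNorm_diffQuot₂_sub_le hn hs1 hΩ (ne_of_gt hε))

end MemSobolev

end Sobolev

end Heis

end

theorem mainTheorem4_general {n : ℕ} (hn : 1 ≤ n) (s : ℝ≥0∞) (hs1 : 1 ≤ s)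
    (Ω : Set (Heis n)) (hΩ : IsOpen Ω) (f : Heis n → ℝ) (hf : Heis.MemSobolev Ω s 2 f)
    (A : Set (Heis n)) (hAΩ : A ⊆ Ω) (hdist : 0 < Heis.ccSetDist A (frontier Ω)) :
    (Heis.HasWeakDeriv Ω Heis.T f (Heis.weakDeriv Ω Heis.T f) ∧
      MemLp (Heis.weakDeriv Ω Heis.T f) s (volume.restrict Ω)) ∧
    (∀ w : Heis n,
      MemLp (fun p => 1 / 2 * inner ℝ (Heis.hHess Ω f p w.1) w.1 +
        w.2 * Heis.weakDeriv Ω Heis.T f p) s (volume.restrict A) ∧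
      (s ≠ ⊤ → Tendsto (fun ε : ℝ => eLpNorm (fun p => Heis.diffQuot₂ Ω f w ε p -
          (1 / 2 * inner ℝ (Heis.hHess Ω f p w.1) w.1 + w.2 * Heis.weakDeriv Ω Heis.T f p))
        s (volume.restrict A)) (𝓝[>] 0) (𝓝 0))) ∧
    (∀ (w : Heis n) (ε : ℝ), 0 < ε →
      ENNReal.ofReal (ε * (‖w.1‖ + 2 * √|w.2|)) < Heis.ccSetDist A (frontier Ω) →
      MemLp (Heis.diffQuot₂ Ω f w ε) s (volume.restrict A) ∧
      eLpNorm (Heis.diffQuot₂ Ω f w ε) s (volume.restrict A) ≤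
        ENNReal.ofReal |w.2| * eLpNorm (Heis.weakDeriv Ω Heis.T f) s (volume.restrict Ω) +
        ENNReal.ofReal (‖w.1‖ ^ 2) *
          eLpNorm (fun p => ‖Heis.hHess Ω f p‖) s (volume.restrict Ω)) := by
  refine ⟨⟨hf.hasWeakDeriv_T hn hΩ, hf.memLp_weakDeriv_T hn hΩ⟩, fun w => ⟨?_, fun hs => ?_⟩,
    fun w ε hε hεw => ?_⟩
  · exact (hf.memLp_taylor_two hn hΩ w).mono_measure (Measure.restrict_mono hAΩ le_rfl)
  · exact hf.tendsto_diffQuot₂ hn hs1 hs hΩ hAΩ hdist w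
  · have hcore := Measure.restrict_mono
      (Heis.subset_twoStepCore_dil hn hΩ hAΩ hε hεw) le_rfl (μ := volume)
    refine ⟨(hf.memLp_diffQuot₂ hΩ).mono_measure hcore, (eLpNorm_mono_measure _ hcore).trans
      ((hf.eLpNorm_diffQuot₂_le hn hs1 hΩ hε.ne').trans ?_)⟩
    rw [Real.enorm_eq_ofReal_abs]
    gcongr
    exact Heis.eLpNorm_inner_hHess_le f w.1 _

theorem mainTheorem4 {n : ℕ} (hn : 1 ≤ n) (s : ℝ≥0∞) (hs1 : 1 ≤ s) (hs : s ≠ ⊤)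
    (Ω : Set (Heis n)) (hΩ : IsOpen Ω) (f : Heis n → ℝ) (hf : Heis.MemSobolev Ω s 2 f)
    (A : Set (Heis n)) (hA : IsOpen A) (hAΩ : A ⊆ Ω)
    (hdist : 0 < Heis.ccSetDist A (frontier Ω)) :
    (Heis.HasWeakDeriv Ω Heis.T f (Heis.weakDeriv Ω Heis.T f) ∧
      MemLp (Heis.weakDeriv Ω Heis.T f) s (volume.restrict Ω)) ∧
    (∀ w : Heis n,
      MemLp (fun p => 1 / 2 * inner ℝ (Heis.hHess Ω f p w.1) w.1 +
        w.2 * Heis.weakDeriv Ω Heis.T f p) s (volume.restrict A) ∧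
      Tendsto (fun ε : ℝ => eLpNorm (fun p => Heis.diffQuot₂ Ω f w ε p -
          (1 / 2 * inner ℝ (Heis.hHess Ω f p w.1) w.1 + w.2 * Heis.weakDeriv Ω Heis.T f p))
        s (volume.restrict A)) (𝓝[>] 0) (𝓝 0)) ∧
    (∀ (w : Heis n) (ε : ℝ), 0 < ε →
      ENNReal.ofReal (ε * (‖w.1‖ + 2 * √|w.2|)) < Heis.ccSetDist A (frontier Ω) →
      MemLp (Heis.diffQuot₂ Ω f w ε) s (volume.restrict A) ∧
      eLpNorm (Heis.diffQuot₂ Ω f w ε) s (volume.restrict A) ≤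
        ENNReal.ofReal |w.2| * eLpNorm (Heis.weakDeriv Ω Heis.T f) s (volume.restrict Ω) +
        ENNReal.ofReal (‖w.1‖ ^ 2) *
          eLpNorm (fun p => ‖Heis.hHess Ω f p‖) s (volume.restrict Ω)) := by
  obtain ⟨hT, hlim, hbound⟩ := mainTheorem4_general hn s hs1 Ω hΩ f hf A hAΩ hdist
  exact ⟨hT, fun w => ⟨(hlim w).1, (hlim w).2 hs⟩, hbound⟩
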